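/- Let $\mathcal H$ and $\mathcal X$ be (real or complex) Hilbert spaces. A family $U(t,s)\in\mathcal L(\mathcal H)$, $s\le t$ in an interval $I$, is an evolution operator on $I$ if $U(t,t)=\mathbf I$, $U(t,r)U(r,s)=U(t,s)$ for $s\le r\le t$, and $U(\cdot,s)$ and $U(t,\cdot)$ are strongly continuous. Let $Y(t,s)$ be an evolution operator on $[0,\infty)$ (generated by $A_c(t)$). For an operator function $D(t)$, let $Y_D$ denote the evolution operator satisfying $$Y_D(t,s)w=Y(t,s)w+\int_s^tY(t,r)D(r)Y_D(r,s)w\,dr,\qquad w\in\mathcal H .$$ An evolution operator $U$ on $[0,\infty)$ is exponentially stable if $\|U(t,s)\|\le Me^{-\alpha(t-s)}$ for all $0\le s\le t$, with some $M\ge0$, $\alpha>0$. Let $B_c(t)\in\mathcal L(\mathcal X,\mathcal H)$, $W_c(t)\in\mathcal L(\mathcal H)$ and $R_c(t)\in\mathcal L(\mathcal X)$ be norm-continuous and uniformly bounded on $[0,\infty)$, let $W_c(t)$ be self-adjoint and nonnegative, let $R_c(t)$ be self-adjoint and coercive uniformly in $t$, and let $P_0\in\mathcal L(\mathcal H)$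 be self-adjoint and nonnegative. Assume that * $(A_c,B_c)$ is uniformly stabilizable: there is a norm-continuous, uniformly bounded $K:[0,\infty)\to\mathcal L(\mathcal H,\mathcal X)$ such that $Y_{B_cK}$ exists and is exponentially stable; * $(A_c,W_c^{1/2})$ is uniformly detectable: there is a norm-continuous, uniformly bounded $L:[0,\infty)\to\mathcal L(\mathcal H)$ such that $Y_{LW_c^{1/2}}$ exists and is exponentially stable. For $t_f>0$ let $P_{t_f}:[0,t_f]\to\mathcal L(\mathcal H)$, strongly measurable and essentially bounded, be the solution, together with the evolution operator $Y_{-B_cK_{t_f}}$ on $[0,t_f]$, where $K_{t_f}(t)=R_c^{-1}(t)B_c^*(t)P_{t_f}(t)$ is the optimal feedback, of the integral Riccati equation $$P_{t_f}(s)z=Y_{-B_cK_{t_f}}^*(t_f,s)P_0Y_{-B_cK_{t_f}}(t_f,s)z+\int_s^{t_f}Y_{-B_cK_{t_f}}^*(r,s)\bigl(W_c(r)+P_{t_f}(r)B_c(r)R_c^{-1}(r)B_c^*(r)P_{t_f}(r)\bigr)Y_{-B_cK_{t_f}}(r,s)z\,dr$$ for all $s\in[0,t_f]$ and $z\in\mathcal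 H$. Then there are constants $\delta_P,\delta_Y$, independent of $t_f$, such that for every $t_f>0$ $$\|P_{t_f}(0)\|\le\delta_P\qquad\text{and}\qquad \|Y_{-B_cK_{t_f}}(t,s)\|\le\delta_Y\quad\text{for all }0\le s\le t\le t_f .$$ -/

import Mathlib

open MeasureTheory Set

section EvolutionOperators

variable {𝕜 : Type*} [RCLike 𝕜]
  {H : Type*} [NormedAddCommGroup H] [InnerProductSpace 𝕜 H]

/-- `U(t,s)`, for `s ≤ t` in the time interval `I`, is an evolution operator: `U(t,t)` is the
identity, `U(t,r) U(r,s) = U(t,s)`, and `U` is strongly continuous in each of its two arguments.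
The values `U t s` with `t < s` or with `t` or `s` outside `I` play no role. -/
structure IsEvolutionOperator (I : Set ℝ) (U : ℝ → ℝ → H →L[𝕜] H) : Prop where
  refl : ∀ t ∈ I, U t t = ContinuousLinearMap.id 𝕜 H
  comp : ∀ s ∈ I, ∀ r ∈ I, ∀ t ∈ I, s ≤ r → r ≤ t → U t r ∘L U r s = U t s
  continuousOn_left : ∀ s ∈ I, ∀ x : H, ContinuousOn (fun t => U t s x) (I ∩ Ici s)
  continuousOn_right : ∀ t ∈ I, ∀ x : H, ContinuousOn (fun s => U t s x) (I ∩ Iic t)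

/-- `V` is the evolution operator obtained from the evolution operator `Y` by the perturbation
`D(t)` of its generator: for `s ≤ t` in `I`,
`V(t,s) w = Y(t,s) w + ∫ₛᵗ Y(t,r) D(r) V(r,s) w dr`, as a Bochner integral. -/
structure IsPerturbedEvolutionOperator [NormedSpace ℝ H] (I : Set ℝ) (Y : ℝ → ℝ → H →L[𝕜] H)
    (D : ℝ → H →L[𝕜] H) (V : ℝ → ℝ → H →L[𝕜] H) : Prop where
  evolution : IsEvolutionOperator I V
  integrable : ∀ s ∈ I, ∀ t ∈ I, s ≤ t → ∀ w : H,
    IntervalIntegrable (fun r => Y t r (D r (V r s w))) volume s t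
  eq : ∀ s ∈ I, ∀ t ∈ I, s ≤ t → ∀ w : H,
    V t s w = Y t s w + ∫ r in s..t, Y t r (D r (V r s w))

/-- Exponential stability of an evolution operator on `0 ≤ s ≤ t < ∞`. -/
def IsExponentiallyStable (Y : ℝ → ℝ → H →L[𝕜] H) : Prop :=
  ∃ M ≥ (0 : ℝ), ∃ α > (0 : ℝ), ∀ s t : ℝ, 0 ≤ s → s ≤ t → ‖Y t s‖ ≤ M * Real.exp (-α * (t - s))

end EvolutionOperators

section BoundedContinuous

variable {𝕜 : Type*} [RCLike 𝕜]
  {E : Type*} [NormedAddCommGroup E] [InnerProductSpace 𝕜 E]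
  {F : Type*} [NormedAddCommGroup F] [InnerProductSpace 𝕜 F]

/-- An operator-valued function on `[0,∞)` that is continuous in operator norm and uniformly
bounded. -/
def IsBoundedContinuous (G : ℝ → E →L[𝕜] F) : Prop :=
  ContinuousOn G (Ici 0) ∧ ∃ C : ℝ, ∀ t : ℝ, 0 ≤ t → ‖G t‖ ≤ C

/-- An operator-valued function on `[0,T]` that is strongly measurable (that is, `t ↦ G(t) x` is
strongly measurable for each `x`) and essentially bounded. -/
def IsStronglyMeasurableEssBounded (T : ℝ) (G : ℝ → E →L[𝕜] F) : Prop :=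
  (∀ x : E, AEStronglyMeasurable (fun t => G t x) (volume.restrict (Icc 0 T))) ∧
    ∃ C : ℝ, ∀ᵐ t ∂(volume.restrict (Icc 0 T)), ‖G t‖ ≤ C

end BoundedContinuous

section Control

variable {𝕜 : Type*} [RCLike 𝕜]
  {H : Type*} [NormedAddCommGroup H] [InnerProductSpace 𝕜 H] [NormedSpace ℝ H]
  {X : Type*} [NormedAddCommGroup X] [InnerProductSpace 𝕜 X]

/-- Uniform detectability of `(A_c, C)`, where `A_c(t)` generates the evolution operator `Y`:
some bounded continuous output injection `L` makes the evolution operator generated by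
`A_c(t) + L(t) C(t)` exponentially stable. -/
def IsUniformlyDetectable (Y : ℝ → ℝ → H →L[𝕜] H) (C : ℝ → H →L[𝕜] X) : Prop :=
  ∃ L : ℝ → X →L[𝕜] H, IsBoundedContinuous L ∧
    ∃ YL : ℝ → ℝ → H →L[𝕜] H,
      IsPerturbedEvolutionOperator (Ici 0) Y (fun t => L t ∘L C t) YL ∧ IsExponentiallyStable YL

/-- Uniform stabilizability of `(A_c, B)`, where `A_c(t)` generates the evolution operator `Y`:
some bounded continuous feedback `K` makes the evolution operator generated by
`A_c(t) + B(t) K(t)` exponentially stable. -/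
def IsUniformlyStabilizable (Y : ℝ → ℝ → H →L[𝕜] H) (B : ℝ → X →L[𝕜] H) : Prop :=
  ∃ K : ℝ → H →L[𝕜] X, IsBoundedContinuous K ∧
    ∃ YK : ℝ → ℝ → H →L[𝕜] H,
      IsPerturbedEvolutionOperator (Ici 0) Y (fun t => B t ∘L K t) YK ∧ IsExponentiallyStable YK

/-- `S(t)` is the square root `W(t)^{1/2}`, i.e. the (unique) nonnegative self-adjoint operator
with square `W(t)`, for each `t ≥ 0`. -/
def IsPositiveSqrt (S W : ℝ → H →L[𝕜] H) : Prop :=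
  ∀ t : ℝ, 0 ≤ t → (S t).IsPositive ∧ S t ∘L S t = W t

variable [CompleteSpace H] [CompleteSpace X]

/-- The feedback operator `K(t) = R(t)⁻¹ B(t)* P(t)`. -/
noncomputable def riccatiFeedback (B : ℝ → X →L[𝕜] H) (R : ℝ → X →L[𝕜] X) (P : ℝ → H →L[𝕜] H)
    (t : ℝ) : H →L[𝕜] X :=
  (R t).inverse ∘L (B t).adjoint ∘L P t

/-- `P` solves on `[0,T]` the integral Riccati equation of the linear quadratic control problem
with dynamics `(Y, B)`, terminal weight `P₀`, state weight `W` and control weight `R`, and `V` is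
the closed-loop evolution operator: with `K(t) = R(t)⁻¹ B(t)* P(t)`, `V` is the perturbation of
`Y` by `-B(t) K(t)`, and for all `s ∈ [0,T]`, `x ∈ H`,
`P(s) x = V(T,s)* P₀ V(T,s) x + ∫ₛᵀ V(r,s)* (W(r) + P(r) B(r) R(r)⁻¹ B(r)* P(r)) V(r,s) x dr`,
as a Bochner integral. -/
structure IsRiccatiSolution (Y : ℝ → ℝ → H →L[𝕜] H) (B : ℝ → X →L[𝕜] H) (P₀ : H →L[𝕜] H)
    (W : ℝ → H →L[𝕜] H) (R : ℝ → X →L[𝕜] X) (T : ℝ)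
    (P : ℝ → H →L[𝕜] H) (V : ℝ → ℝ → H →L[𝕜] H) : Prop where
  bounded : IsStronglyMeasurableEssBounded T P
  closedLoop : IsPerturbedEvolutionOperator (Icc 0 T) Y
    (fun t => -(B t ∘L riccatiFeedback B R P t)) V
  integrable : ∀ s ∈ Icc 0 T, ∀ x : H, IntervalIntegrable
    (fun r => (V r s).adjoint ((W r + P r ∘L B r ∘L riccatiFeedback B R P r) (V r s x)))
    volume s T
  eq : ∀ s ∈ Icc 0 T, ∀ x : H,
    P s x = (V T s).adjoint (P₀ (V T s x)) +
      ∫ r in s..T, (V r s).adjoint ((W r + P r ∘L B r ∘L riccatiFeedback B R P r) (V r s x))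

end Control

/-
The Riccati feedback is optimal: `re ⟪x, P(s)x⟫` is the cost of the closed-loop trajectory starting
from `x` at time `s`, and it is at most the cost of any other control. Comparing with the
exponentially stabilizing feedback bounds `P(s)` uniformly in `s` and in the final time. On the
other hand, the perturbation formula writes a closed-loop trajectory as the exponentially stable
evolution of the injected system plus a forcing term controlled pointwise by the running cost, whose
integral is at most `re ⟪x, P(s)x⟫`; so the closed loop is uniformly bounded as well.
The square root `W^{1/2}` inherits norm continuity from `W` because `‖S - T‖² ≤ ‖S² - T²‖` for
positive `S` and `T`.
-/

open scoped InnerProductSpace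

section Gronwall

lemma exp_neg_mul_le_one {c x : ℝ} (hc : 0 ≤ c) (hx : 0 ≤ x) : Real.exp (-c * x) ≤ 1 :=
  Real.exp_le_one_iff.2 (mul_nonpos_of_nonpos_of_nonneg (neg_nonpos.2 hc) hx)

lemma exp_neg_two_mul_mul (c x : ℝ) : Real.exp (-(2 * c) * x) = Real.exp (-c * x) ^ 2 := by
  rw [← Real.exp_nat_mul]
  congr 1
  push_cast
  ring

lemma intervalIntegral_exp_mul {c : ℝ} (hc : c ≠ 0) (b : ℝ) :
    ∫ r in 0..b, Real.exp (c * r) = (Real.exp (c * b) - 1) / c := by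
  rw [intervalIntegral.integral_comp_mul_left _ hc, integral_exp, mul_zero, Real.exp_zero,
    smul_eq_mul, inv_mul_eq_div]

lemma intervalIntegral_exp_neg_mul_le {c : ℝ} (hc : 0 < c) (b : ℝ) :
    ∫ r in 0..b, Real.exp (-c * r) ≤ 1 / c := by
  rw [intervalIntegral_exp_mul (neg_ne_zero.mpr hc.ne'), div_neg, ← neg_div]
  gcongr
  linarith [Real.exp_pos (-c * b)]

lemma intervalIntegral_exp_neg_mul_sub_left_le {c : ℝ} (hc : 0 < c) (a b : ℝ) :
    ∫ r in a..b, Real.exp (-c * (r - a)) ≤ 1 / c := by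
  rw [intervalIntegral.integral_comp_sub_right fun r => Real.exp (-c * r), sub_self]
  exact intervalIntegral_exp_neg_mul_le hc _

lemma intervalIntegral_exp_neg_mul_sub_right_le {c : ℝ} (hc : 0 < c) (a b : ℝ) :
    ∫ r in a..b, Real.exp (-c * (b - r)) ≤ 1 / c := by
  rw [intervalIntegral.integral_comp_sub_left fun r => Real.exp (-c * r), sub_self]
  exact intervalIntegral_exp_neg_mul_le hc _

lemma norm_intervalIntegral_le_mul_integral {E : Type*} [NormedAddCommGroup E] [NormedSpace ℝ E]
    {a b C : ℝ} (hab : a ≤ b) {f : ℝ → E} {g : ℝ → ℝ} (hg : Continuous g)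
    (h : ∀ᵐ r ∂volume.restrict (Icc a b), ‖f r‖ ≤ C * g r) :
    ‖∫ r in a..b, f r‖ ≤ C * ∫ r in a..b, g r := by
  rw [← intervalIntegral.integral_const_mul]
  refine intervalIntegral.norm_integral_le_of_norm_le hab ?_
    ((hg.intervalIntegrable a b).const_mul C)
  rw [ae_restrict_iff' measurableSet_Icc] at h
  filter_upwards [h] with r hr hmem
  exact hr (Ioc_subset_Icc_self hmem)

-- The operator norm of a strongly continuous family need not be measurable, so the integral
-- inequality is assumed for the continuous majorants of `f` instead of `f` itself.
lemma le_exp_of_forall_majorant_le_add_integral {a b A C M : ℝ} {f : ℝ → ℝ} (hA : 0 ≤ A)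
    (hC : 0 ≤ C) (hM : ∀ t ∈ Icc a b, f t ≤ M)
    (h : ∀ g : ℝ → ℝ, Continuous g → (∀ r, 0 ≤ g r) → (∀ r ∈ Icc a b, f r ≤ g r) →
      ∀ t ∈ Icc a b, f t ≤ A + C * ∫ r in a..t, g r) {t : ℝ} (ht : t ∈ Icc a b) :
    f t ≤ 2 * A * Real.exp ((2 * C + 1) * (t - a)) := by
  set l := 2 * C + 1
  have hl_pos : 0 < l := by positivity
  have one_le_exp : ∀ t ∈ Icc a b, 1 ≤ Real.exp (l * (t - a)) := fun t ht =>
    Real.one_le_exp (mul_nonneg hl_pos.le (sub_nonneg.mpr ht.1))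
  have improve : ∀ N, 0 ≤ N → (∀ t ∈ Icc a b, f t ≤ N * Real.exp (l * (t - a))) →
      ∀ t ∈ Icc a b, f t ≤ (A + N / 2) * Real.exp (l * (t - a)) := by
    intro N hN hf t ht
    have hft := h (fun t => N * Real.exp (l * (t - a))) (by fun_prop) (fun r => by positivity) hf
      t ht
    rw [intervalIntegral.integral_const_mul,
      intervalIntegral.integral_comp_sub_right fun r => Real.exp (l * r), sub_self,
      intervalIntegral_exp_mul hl_pos.ne'] at hft
    have hexp := one_le_exp t ht
    have hCl : C / l ≤ 1 / 2 := by rw [div_le_iff₀ hl_pos]; linarith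
    calc f t ≤ A + C / l * (N * (Real.exp (l * (t - a)) - 1)) := hft.trans_eq (by ring)
      _ ≤ A + 1 / 2 * (N * (Real.exp (l * (t - a)) - 1)) := by
        gcongr
      _ ≤ (A + N / 2) * Real.exp (l * (t - a)) := by nlinarith
  set S := {N | 0 ≤ N ∧ ∀ t ∈ Icc a b, f t ≤ N * Real.exp (l * (t - a))}
  have hS_bdd : BddBelow S := ⟨0, fun _ hN => hN.1⟩
  have hS_nonempty : S.Nonempty := ⟨|M|, abs_nonneg M, fun t ht => ((hM t ht).trans
    (le_abs_self M)).trans (le_mul_of_one_le_right (abs_nonneg M) (one_le_exp t ht))⟩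
  have hS_improve : ∀ N ∈ S, sInf S ≤ A + N / 2 := fun N hN =>
    csInf_le hS_bdd ⟨by linarith [hN.1], improve N hN.1 hN.2⟩
  have hS_le : 2 * (sInf S - A) ≤ sInf S :=
    le_csInf hS_nonempty fun N hN => by linarith [hS_improve N hN]
  calc f t ≤ sInf S * Real.exp (l * (t - a)) := by
        rw [← div_le_iff₀ (Real.exp_pos _)]
        exact le_csInf hS_nonempty fun N hN => (div_le_iff₀ (Real.exp_pos _)).mpr (hN.2 t ht)
    _ ≤ 2 * A * Real.exp (l * (t - a)) := by
        gcongr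
        linarith

lemma le_exp_of_forall_majorant_le_add_integral_right {a b A C M : ℝ} {f : ℝ → ℝ} (hA : 0 ≤ A)
    (hC : 0 ≤ C) (hM : ∀ t ∈ Icc a b, f t ≤ M)
    (h : ∀ g : ℝ → ℝ, Continuous g → (∀ r, 0 ≤ g r) → (∀ r ∈ Icc a b, f r ≤ g r) →
      ∀ t ∈ Icc a b, f t ≤ A + C * ∫ r in t..b, g r) {t : ℝ} (ht : t ∈ Icc a b) :
    f t ≤ 2 * A * Real.exp ((2 * C + 1) * (b - t)) := by
  have reflect_mem : ∀ {t}, t ∈ Icc a b → a + b - t ∈ Icc a b := fun ht =>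
    ⟨by linarith [ht.2], by linarith [ht.1]⟩
  have hreflect := le_exp_of_forall_majorant_le_add_integral (f := fun t => f (a + b - t)) hA hC
    (fun t ht => hM _ (reflect_mem ht)) (fun g hg hg_nonneg hfg t ht => by
      have hft := h (fun r => g (a + b - r)) (by fun_prop) (fun r => hg_nonneg _)
        (fun r hr => by simpa using hfg _ (reflect_mem hr)) _ (reflect_mem ht)
      rw [intervalIntegral.integral_comp_sub_left] at hft
      simpa using hft) (reflect_mem ht)
  have hlength : a + b - t - a = b - t := by ring
  simpa [hlength] using hreflect

end Gronwall

section Operators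

variable {𝕜 : Type*} [RCLike 𝕜]
  {E : Type*} [NormedAddCommGroup E] [InnerProductSpace 𝕜 E]
  {F : Type*} [NormedAddCommGroup F] [InnerProductSpace 𝕜 F]

lemma opNorm_le_of_norm_inner_le {A : E →L[𝕜] F} {C : ℝ} (hC : 0 ≤ C)
    (h : ∀ x y, ‖⟪y, A x⟫_𝕜‖ ≤ C * ‖x‖ * ‖y‖) : ‖A‖ ≤ C :=
  ContinuousLinearMap.opNorm_le_of_re_inner_le hC fun x y hx hy => by
    rw [inner_re_symm]
    simpa [hx, hy] using (RCLike.re_le_norm _).trans (h x y)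

lemma abs_re_inner_le_mul {x y : E} {a b : ℝ} (hx : ‖x‖ ≤ a) (hy : ‖y‖ ≤ b) :
    |RCLike.re ⟪x, y⟫_𝕜| ≤ a * b :=
  ((RCLike.abs_re_le_norm _).trans (norm_inner_le_norm x y)).trans
    (mul_le_mul hx hy (norm_nonneg y) ((norm_nonneg x).trans hx))

lemma abs_re_inner_apply_self_le {A : E →L[𝕜] E} {x : E} {C m : ℝ} (hA : ‖A‖ ≤ C)
    (hx : ‖x‖ ≤ m) : |RCLike.re ⟪x, A x⟫_𝕜| ≤ C * m ^ 2 :=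
  (abs_re_inner_le_mul hx (A.le_of_opNorm_le_of_le hA hx)).trans_eq (by ring)

lemma exists_norm_eq_one_lt_abs_re_inner {A : E →L[𝕜] E} (hA : A.IsSymmetric) {m : ℝ}
    (hm₀ : 0 ≤ m) (hm : m < ‖A‖) : ∃ x, ‖x‖ = 1 ∧ m < |RCLike.re ⟪x, A x⟫_𝕜| := by
  rw [A.norm_eq_iSup_rayleighQuotient hA] at hm
  obtain ⟨x, hx⟩ := exists_lt_of_lt_ciSup hm
  have hx₀ : x ≠ 0 := by
    rintro rfl
    simp only [ContinuousLinearMap.rayleighQuotient_apply_zero, abs_zero] at hx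
    exact hm₀.not_gt hx
  obtain ⟨c, hc₀, hc⟩ : ∃ c : 𝕜, c ≠ 0 ∧ ‖c • x‖ = 1 :=
    ⟨(‖x‖ : 𝕜)⁻¹, by simpa using hx₀, norm_smul_inv_norm hx₀⟩
  refine ⟨c • x, hc, ?_⟩
  rwa [← A.rayleigh_smul x hc₀, ContinuousLinearMap.rayleighQuotient,
    ContinuousLinearMap.reApplyInnerSelf_apply, hc, one_pow, div_one, inner_re_symm] at hx

lemma opNorm_le_of_isPositive_of_re_inner_le {A : E →L[𝕜] E} (hA : A.IsPositive) {C : ℝ}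
    (hC : 0 ≤ C) (h : ∀ x, ‖x‖ = 1 → RCLike.re ⟪x, A x⟫_𝕜 ≤ C) : ‖A‖ ≤ C := by
  by_contra! hlt
  obtain ⟨x, hx, hx_lt⟩ := exists_norm_eq_one_lt_abs_re_inner hA.isSymmetric hC hlt
  rw [abs_of_nonneg (hA.re_inner_nonneg_right x)] at hx_lt
  exact (h x hx).not_gt hx_lt

lemma norm_apply_sub_re_inner_smul_le (A : E →L[𝕜] E) {x : E} (hx : ‖x‖ = 1) :
    ‖A x - (RCLike.re ⟪x, A x⟫_𝕜 : 𝕜) • x‖ ≤ √(‖A‖ ^ 2 - RCLike.re ⟪x, A x⟫_𝕜 ^ 2) := by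
  apply Real.le_sqrt_of_sq_le
  have hAx : ‖A x‖ ^ 2 ≤ ‖A‖ ^ 2 := by
    gcongr
    exact A.unit_le_opNorm x hx.le
  rw [norm_sub_sq (𝕜 := 𝕜), inner_smul_right, RCLike.re_ofReal_mul, inner_re_symm (A x), norm_smul,
    hx, RCLike.norm_ofReal, mul_one, sq_abs]
  linarith

-- Uses `S² - T² = S (S - T) + (S - T) T`.
lemma re_inner_comp_self_sub_comp_self {S T : E →L[𝕜] E} (hS : S.IsSymmetric)
    (hT : T.IsSymmetric) (x : E) (c : ℝ) :
    RCLike.re ⟪x, (S ∘L S - T ∘L T) x⟫_𝕜 =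
      c * (RCLike.re ⟪x, S x⟫_𝕜 + RCLike.re ⟪x, T x⟫_𝕜) +
        RCLike.re ⟪S x, (S - T) x - (c : 𝕜) • x⟫_𝕜 +
        RCLike.re ⟪(S - T) x - (c : 𝕜) • x, T x⟫_𝕜 := by
  have hfactor : (S ∘L S - T ∘L T) x = S ((S - T) x) + (S - T) (T x) := by simp
  have hsub : ⟪x, (S - T) (T x)⟫_𝕜 = ⟪(S - T) x, T x⟫_𝕜 := ((hS.sub hT) x (T x)).symm
  have hSS : ⟪S x, (S - T) x⟫_𝕜 = ⟪x, S ((S - T) x)⟫_𝕜 := hS x _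
  have hSx : ⟪S x, x⟫_𝕜 = ⟪x, S x⟫_𝕜 := hS x x
  rw [hfactor, inner_add_right, hsub, inner_sub_right, inner_sub_left, inner_smul_left,
    inner_smul_right, RCLike.conj_ofReal, hSS, hSx]
  simp only [map_add, map_sub, RCLike.re_ofReal_mul]
  ring

-- For a unit eigenvector `x` of `S - T` the square root vanishes; in general it measures the
-- failure of `x` to be one.
lemma sq_re_inner_sub_apply_le {S T : E →L[𝕜] E} (hS : S.IsPositive) (hT : T.IsPositive) {x : E}
    (hx : ‖x‖ = 1) :
    RCLike.re ⟪x, (S - T) x⟫_𝕜 ^ 2 ≤ ‖S ∘L S - T ∘L T‖ +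
      (‖S‖ + ‖T‖) * √(‖S - T‖ ^ 2 - RCLike.re ⟪x, (S - T) x⟫_𝕜 ^ 2) := by
  set l := RCLike.re ⟪x, (S - T) x⟫_𝕜 with hl
  set e := (S - T) x - (l : 𝕜) • x with he
  have he_norm : ‖e‖ ≤ √(‖S - T‖ ^ 2 - l ^ 2) := norm_apply_sub_re_inner_smul_le (S - T) hx
  have hl_abs : |l| ≤ RCLike.re ⟪x, S x⟫_𝕜 + RCLike.re ⟪x, T x⟫_𝕜 := by
    have hSx := hS.re_inner_nonneg_right x
    have hTx := hT.re_inner_nonneg_right x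
    rw [hl, sub_apply, inner_sub_right, map_sub]
    exact abs_sub_le_iff.mpr ⟨by linarith, by linarith⟩
  have hdefect : l * (RCLike.re ⟪x, S x⟫_𝕜 + RCLike.re ⟪x, T x⟫_𝕜) =
      RCLike.re ⟪x, (S ∘L S - T ∘L T) x⟫_𝕜 - RCLike.re ⟪S x, e⟫_𝕜 - RCLike.re ⟪e, T x⟫_𝕜 := by
    rw [re_inner_comp_self_sub_comp_self hS.isSymmetric hT.isSymmetric x l, ← he]
    ring
  have hw : |RCLike.re ⟪x, (S ∘L S - T ∘L T) x⟫_𝕜| ≤ ‖S ∘L S - T ∘L T‖ := by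
    simpa using abs_re_inner_le_mul (𝕜 := 𝕜) hx.le ((S ∘L S - T ∘L T).unit_le_opNorm x hx.le)
  have hSe : |RCLike.re ⟪S x, e⟫_𝕜| ≤ ‖S‖ * ‖e‖ :=
    abs_re_inner_le_mul (S.unit_le_opNorm x hx.le) le_rfl
  have hTe : |RCLike.re ⟪e, T x⟫_𝕜| ≤ ‖e‖ * ‖T‖ :=
    abs_re_inner_le_mul le_rfl (T.unit_le_opNorm x hx.le)
  calc l ^ 2 = |l| * |l| := by rw [← sq, sq_abs]
    _ ≤ |l| * |RCLike.re ⟪x, S x⟫_𝕜 + RCLike.re ⟪x, T x⟫_𝕜| :=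
      mul_le_mul_of_nonneg_left (hl_abs.trans (le_abs_self _)) (abs_nonneg l)
    _ ≤ |RCLike.re ⟪x, (S ∘L S - T ∘L T) x⟫_𝕜| + |RCLike.re ⟪S x, e⟫_𝕜| +
        |RCLike.re ⟪e, T x⟫_𝕜| := by
      rw [← abs_mul, hdefect]
      exact (abs_sub _ _).trans (add_le_add_left (abs_sub _ _) _)
    _ ≤ ‖S ∘L S - T ∘L T‖ + (‖S‖ + ‖T‖) * ‖e‖ := by linarith
    _ ≤ ‖S ∘L S - T ∘L T‖ + (‖S‖ + ‖T‖) * √(‖S - T‖ ^ 2 - l ^ 2) := by gcongr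

lemma sq_norm_sub_le_norm_comp_self_sub {S T : E →L[𝕜] E} (hS : S.IsPositive)
    (hT : T.IsPositive) : ‖S - T‖ ^ 2 ≤ ‖S ∘L S - T ∘L T‖ := by
  rcases (norm_nonneg (S - T)).eq_or_lt with hD | hD
  · simp [← hD]
  have hcont : ContinuousWithinAt
      (fun m => ‖S ∘L S - T ∘L T‖ + (‖S‖ + ‖T‖) * √(‖S - T‖ ^ 2 - m ^ 2) - m ^ 2)
      (Iio ‖S - T‖) ‖S - T‖ := by fun_prop
  have hlim := ge_of_tendsto hcont.tendsto (b := 0) <| by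
    filter_upwards [Ioo_mem_nhdsLT hD] with m hm
    obtain ⟨x, hx, hmx⟩ := exists_norm_eq_one_lt_abs_re_inner (A := S - T)
      (hS.isSymmetric.sub hT.isSymmetric) hm.1.le hm.2
    have hm_sq : m ^ 2 ≤ RCLike.re ⟪x, (S - T) x⟫_𝕜 ^ 2 := by
      rw [← sq_abs (RCLike.re _)]
      exact pow_le_pow_left₀ hm.1.le hmx.le 2
    rw [sub_nonneg]
    refine hm_sq.trans ((sq_re_inner_sub_apply_le hS hT hx).trans ?_)
    gcongr
  simpa using hlim

lemma continuousOn_of_isPositive_of_comp_self {α : Type*} [TopologicalSpace α] {s : Set α}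
    {S : α → E →L[𝕜] E} (hS : ∀ t ∈ s, (S t).IsPositive)
    (hS_sq : ContinuousOn (fun t => S t ∘L S t) s) : ContinuousOn S s := by
  intro t ht
  have hsqrt : ContinuousWithinAt (fun r => √‖S r ∘L S r - S t ∘L S t‖) s t :=
    ((hS_sq t ht).sub continuousWithinAt_const).norm.sqrt
  rw [ContinuousWithinAt, tendsto_iff_norm_sub_tendsto_zero]
  refine squeeze_zero' (.of_forall fun _ => norm_nonneg _) ?_ (by simpa using hsqrt.tendsto)
  filter_upwards [self_mem_nhdsWithin] with r hr
  exact Real.le_sqrt_of_sq_le (sq_norm_sub_le_norm_comp_self_sub (hS r hr) (hS t ht))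

lemma two_mul_re_inner_le_of_isPositive {N : E →L[𝕜] E} (hN : N.IsPositive) (x y : E) :
    2 * RCLike.re ⟪x, N y⟫_𝕜 ≤ RCLike.re ⟪x, N x⟫_𝕜 + RCLike.re ⟪y, N y⟫_𝕜 := by
  have hsub := hN.re_inner_nonneg_right (x - y)
  have hsymm : RCLike.re ⟪y, N x⟫_𝕜 = RCLike.re ⟪x, N y⟫_𝕜 := by
    rw [inner_re_symm, hN.inner_left_eq_inner_right]
  simp only [map_sub, inner_sub_left, inner_sub_right, hsymm] at hsub
  linarith

section Coercive

variable [CompleteSpace E] {δ : ℝ}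

lemma isUnit_of_coercive {N : E →L[𝕜] E} (hδ : 0 < δ)
    (hN : ∀ u, δ * ‖u‖ ^ 2 ≤ RCLike.re ⟪u, N u⟫_𝕜) : IsUnit N := by
  refine N.isUnit_of_forall_le_norm_inner_map (c := ⟨δ, hδ.le⟩) hδ fun x => ?_
  rw [norm_inner_symm, mul_comm]
  exact (hN x).trans (RCLike.re_le_norm _)

lemma apply_inverse_of_coercive {N : E →L[𝕜] E} (hδ : 0 < δ)
    (hN : ∀ u, δ * ‖u‖ ^ 2 ≤ RCLike.re ⟪u, N u⟫_𝕜) (x : E) : N (N.inverse x) = x := by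
  rw [← ContinuousLinearMap.ringInverse_eq_inverse]
  exact DFunLike.congr_fun (Ring.mul_inverse_cancel N (isUnit_of_coercive hδ hN)) x

lemma continuousOn_inverse_of_coercive {α : Type*} [TopologicalSpace α] {s : Set α}
    {N : α → E →L[𝕜] E} (hδ : 0 < δ) (hN : ContinuousOn N s)
    (hN_coercive : ∀ t ∈ s, ∀ u, δ * ‖u‖ ^ 2 ≤ RCLike.re ⟪u, N t u⟫_𝕜) :
    ContinuousOn (fun t => (N t).inverse) s := by
  intro t ht
  obtain ⟨U, hU⟩ := isUnit_of_coercive hδ (hN_coercive t ht)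
  have hcont := NormedRing.inverse_continuousAt U
  rw [hU, ContinuousLinearMap.ringInverse_eq_inverse] at hcont
  exact hcont.comp_continuousWithinAt (hN t ht)

end Coercive

end Operators

section StrongMeasurability

variable {α : Type*} [MeasurableSpace α] {μ ν : Measure α}
  {𝕜 : Type*} [NontriviallyNormedField 𝕜]
  {E : Type*} [NormedAddCommGroup E] [NormedSpace 𝕜 E]
  {F : Type*} [NormedAddCommGroup F] [NormedSpace 𝕜 F]
  {G : Type*} [NormedAddCommGroup G] [NormedSpace 𝕜 G]

lemma exists_bound_of_forall_continuousOn_apply {β : Type*} [TopologicalSpace β] [CompleteSpace E]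
    {K : Set β} (hK : IsCompact K) {A : β → E →L[𝕜] F}
    (hA : ∀ x, ContinuousOn (fun t => A t x) K) : ∃ C, ∀ t ∈ K, ‖A t‖ ≤ C := by
  obtain ⟨C, hC⟩ : ∃ C, ∀ t : K, ‖A t‖ ≤ C := banach_steinhaus fun x => by
    obtain ⟨C, hC⟩ := hK.exists_bound_of_continuousOn (hA x)
    exact ⟨C, fun t => hC t t.2⟩
  exact ⟨C, fun t ht => hC ⟨t, ht⟩⟩

lemma aestronglyMeasurable_clm_apply {A : α → E →L[𝕜] F} {f : α → E}
    (hA : ∀ x, AEStronglyMeasurable (fun t => A t x) μ) (hf : AEStronglyMeasurable f μ) :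
    AEStronglyMeasurable (fun t => A t (f t)) μ := by
  have simpleFunc_apply (g : SimpleFunc α E) : AEStronglyMeasurable (fun t => A t (g t)) μ := by
    induction g using SimpleFunc.induction with
    | @const c s hs =>
      refine ((hA c).indicator hs).congr (Filter.Eventually.of_forall fun t => ?_)
      by_cases ht : t ∈ s <;> simp [ht]
    | add _ hg hg' =>
      simp only [SimpleFunc.coe_add, Pi.add_apply, map_add]
      exact hg.add hg'
  have hmk : AEStronglyMeasurable (fun t => A t (hf.mk f t)) μ :=
    aestronglyMeasurable_of_tendsto_ae Filter.atTop
      (fun n => simpleFunc_apply (hf.stronglyMeasurable_mk.approx n))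
      (Filter.Eventually.of_forall fun t =>
        ((A t).continuous.tendsto _).comp (hf.stronglyMeasurable_mk.tendsto_approx t))
  refine hmk.congr ?_
  filter_upwards [hf.ae_eq_mk] with t ht
  rw [ht]

/-- An essentially bounded family of operators that is almost everywhere strongly measurable in
the strong operator topology. It need not be almost everywhere strongly measurable for the
operator norm, so it need not be an element of `L^∞`. -/
structure IsStronglyEssBounded (μ : Measure α) (A : α → E →L[𝕜] F) : Prop where
  aestronglyMeasurable : ∀ x, AEStronglyMeasurable (fun t => A t x) μ
  exists_bound : ∃ C, ∀ᵐ t ∂μ, ‖A t‖ ≤ C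

lemma exists_ae_norm_le_of_memLp_top {f : α → E} (hf : MemLp f ⊤ μ) :
    ∃ C, ∀ᵐ t ∂μ, ‖f t‖ ≤ C := by
  refine ⟨(eLpNormEssSup f μ).toReal, ?_⟩
  filter_upwards [ae_le_eLpNormEssSup (f := f)] with t ht
  rw [← toReal_enorm]
  refine ENNReal.toReal_mono ?_ ht
  rw [← eLpNorm_exponent_top]
  exact hf.2.ne

lemma memLp_top_of_continuousOn_isCompact [TopologicalSpace α] [OpensMeasurableSpace α]
    [T2Space α] {K : Set α} (hK : IsCompact K) {f : α → E} (hf : ContinuousOn f K) :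
    MemLp f ⊤ (μ.restrict K) := by
  obtain ⟨C, hC⟩ := hK.exists_bound_of_continuousOn hf
  exact memLp_top_of_bound (hf.aestronglyMeasurable_of_isCompact hK hK.measurableSet) C
    (ae_restrict_of_forall_mem hK.measurableSet hC)

lemma intervalIntegrable_of_memLp_top {a b : ℝ} (hab : a ≤ b) {f : ℝ → E}
    (hf : MemLp f ⊤ (volume.restrict (Icc a b))) : IntervalIntegrable f volume a b :=
  (intervalIntegrable_iff_integrableOn_Icc_of_le hab).2 (hf.integrable le_top)

namespace IsStronglyEssBounded

lemma mono_measure {A : α → E →L[𝕜] F} (hA : IsStronglyEssBounded μ A) (h : ν ≤ μ) :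
    IsStronglyEssBounded ν A :=
  ⟨fun x => (hA.aestronglyMeasurable x).mono_measure h,
    hA.exists_bound.imp fun _ hC => ae_mono h hC⟩

lemma add {A B : α → E →L[𝕜] F} (hA : IsStronglyEssBounded μ A)
    (hB : IsStronglyEssBounded μ B) : IsStronglyEssBounded μ (fun t => A t + B t) := by
  obtain ⟨C, hC⟩ := hA.exists_bound
  obtain ⟨C', hC'⟩ := hB.exists_bound
  refine ⟨fun x => (hA.aestronglyMeasurable x).add (hB.aestronglyMeasurable x), C + C', ?_⟩
  filter_upwards [hC, hC'] with t ht ht'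
  exact norm_add_le_of_le ht ht'

lemma neg {A : α → E →L[𝕜] F} (hA : IsStronglyEssBounded μ A) :
    IsStronglyEssBounded μ (fun t => -A t) :=
  ⟨fun x => (hA.aestronglyMeasurable x).neg, by simpa only [norm_neg] using hA.exists_bound⟩

lemma sub {A B : α → E →L[𝕜] F} (hA : IsStronglyEssBounded μ A)
    (hB : IsStronglyEssBounded μ B) : IsStronglyEssBounded μ (fun t => A t - B t) := by
  simpa only [sub_eq_add_neg] using hA.add hB.neg

lemma memLp_apply {A : α → E →L[𝕜] F} {f : α → E} (hA : IsStronglyEssBounded μ A)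
    (hf : MemLp f ⊤ μ) : MemLp (fun t => A t (f t)) ⊤ μ := by
  obtain ⟨C, hC⟩ := hA.exists_bound
  obtain ⟨C', hC'⟩ := exists_ae_norm_le_of_memLp_top hf
  refine memLp_top_of_bound
    (aestronglyMeasurable_clm_apply hA.aestronglyMeasurable hf.aestronglyMeasurable) (C * C') ?_
  filter_upwards [hC, hC'] with t ht ht'
  exact (A t).le_of_opNorm_le_of_le ht ht'

lemma comp {A : α → F →L[𝕜] G} {B : α → E →L[𝕜] F} (hA : IsStronglyEssBounded μ A)
    (hB : IsStronglyEssBounded μ B) : IsStronglyEssBounded μ (fun t => A t ∘L B t) := by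
  obtain ⟨C, hC⟩ := hA.exists_bound
  obtain ⟨C', hC'⟩ := hB.exists_bound
  refine ⟨fun x => aestronglyMeasurable_clm_apply (A := A) hA.aestronglyMeasurable
    (hB.aestronglyMeasurable x), C * C', ?_⟩
  filter_upwards [hC, hC'] with t ht ht'
  exact ((A t).opNorm_comp_le (B t)).trans
    (mul_le_mul ht ht' (norm_nonneg _) ((norm_nonneg _).trans ht))

lemma comp_fst {β : Type*} [MeasurableSpace β] {ρ : Measure β} {A : α → E →L[𝕜] F}
    (hA : IsStronglyEssBounded μ A) : IsStronglyEssBounded (μ.prod ρ) (fun p => A p.1) :=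
  ⟨fun x => (hA.aestronglyMeasurable x).comp_fst,
    hA.exists_bound.imp fun _ hC => Measure.quasiMeasurePreserving_fst.ae hC⟩

lemma of_forall_continuousOn_apply [CompleteSpace E] [TopologicalSpace α]
    [OpensMeasurableSpace α] [T2Space α] {K : Set α} (hK : IsCompact K) {A : α → E →L[𝕜] F}
    (hA : ∀ x, ContinuousOn (fun t => A t x) K) : IsStronglyEssBounded (μ.restrict K) A :=
  ⟨fun x => (hA x).aestronglyMeasurable_of_isCompact hK hK.measurableSet,
    (exists_bound_of_forall_continuousOn_apply hK hA).imp fun _ hC =>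
      ae_restrict_of_forall_mem hK.measurableSet hC⟩

end IsStronglyEssBounded

end StrongMeasurability

section Pairing

variable {α : Type*} [MeasurableSpace α] {μ : Measure α} {𝕜 : Type*} [RCLike 𝕜]
  {E : Type*} [NormedAddCommGroup E] [InnerProductSpace 𝕜 E]

lemma isStronglyEssBounded_innerSL {f : α → E} (hf : MemLp f ⊤ μ) :
    IsStronglyEssBounded μ (fun t => innerSL 𝕜 (f t)) := by
  refine ⟨fun x => ?_, ?_⟩
  · simpa only [innerSL_apply_apply] using hf.aestronglyMeasurable.inner aestronglyMeasurable_const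
  · simpa only [innerSL_apply_norm] using exists_ae_norm_le_of_memLp_top hf

lemma memLp_top_inner {f g : α → E} (hf : MemLp f ⊤ μ) (hg : MemLp g ⊤ μ) :
    MemLp (fun t => ⟪f t, g t⟫_𝕜) ⊤ μ := by
  simpa only [innerSL_apply_apply] using (isStronglyEssBounded_innerSL (𝕜 := 𝕜) hf).memLp_apply hg

end Pairing

section TriangleIntegral

variable {E : Type*} [NormedAddCommGroup E] [NormedSpace ℝ E]

lemma setIntegral_Icc_indicator_Iic {a b ρ : ℝ} (hρ : ρ ∈ Icc a b) (f : ℝ → E) :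
    ∫ r in Icc a b, (Iic ρ).indicator f r = ∫ r in a..ρ, f r := by
  have inter_eq : Icc a b ∩ Iic ρ = Icc a ρ := by
    rw [← Ici_inter_Iic, inter_assoc, Iic_inter_Iic, min_eq_right hρ.2, Ici_inter_Iic]
  rw [setIntegral_indicator measurableSet_Iic, inter_eq, integral_Icc_eq_integral_Ioc,
    intervalIntegral.integral_of_le hρ.1]

lemma setIntegral_Icc_indicator_Ici {a b r : ℝ} (hr : r ∈ Icc a b) (f : ℝ → E) :
    ∫ ρ in Icc a b, (Ici r).indicator f ρ = ∫ ρ in r..b, f ρ := by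
  have inter_eq : Icc a b ∩ Ici r = Icc r b := by
    rw [← Ici_inter_Iic, inter_right_comm, Ici_inter_Ici, max_eq_right hr.1, Ici_inter_Iic]
  rw [setIntegral_indicator measurableSet_Ici, inter_eq, integral_Icc_eq_integral_Ioc,
    intervalIntegral.integral_of_le hr.2]

lemma intervalIntegral_triangle_swap {a b : ℝ} (hab : a ≤ b) {k : ℝ → ℝ → E}
    (hk : Integrable ({p : ℝ × ℝ | p.2 ≤ p.1}.indicator fun p => k p.1 p.2)
      ((volume.restrict (Icc a b)).prod (volume.restrict (Icc a b)))) :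
    ∫ ρ in a..b, ∫ r in a..ρ, k ρ r = ∫ r in a..b, ∫ ρ in r..b, k ρ r := by
  rw [intervalIntegral.integral_of_le hab, intervalIntegral.integral_of_le hab,
    ← integral_Icc_eq_integral_Ioc, ← integral_Icc_eq_integral_Ioc]
  calc ∫ ρ in Icc a b, ∫ r in a..ρ, k ρ r
      = ∫ ρ in Icc a b, ∫ r in Icc a b,
          {p : ℝ × ℝ | p.2 ≤ p.1}.indicator (fun p => k p.1 p.2) (ρ, r) :=
        setIntegral_congr_fun measurableSet_Icc fun ρ hρ =>
          (setIntegral_Icc_indicator_Iic hρ (k ρ)).symm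
    _ = ∫ r in Icc a b, ∫ ρ in Icc a b,
          {p : ℝ × ℝ | p.2 ≤ p.1}.indicator (fun p => k p.1 p.2) (ρ, r) :=
        integral_integral_swap hk
    _ = ∫ r in Icc a b, ∫ ρ in r..b, k ρ r :=
        setIntegral_congr_fun measurableSet_Icc fun r hr =>
          setIntegral_Icc_indicator_Ici hr fun ρ => k ρ r

end TriangleIntegral

section EvolutionProperties

variable {𝕜 : Type*} [RCLike 𝕜]
  {H : Type*} [NormedAddCommGroup H] [InnerProductSpace 𝕜 H]
  {F : Type*} [NormedAddCommGroup F] [NormedSpace 𝕜 F]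
  {I J : Set ℝ} {a b : ℝ} {U : ℝ → ℝ → H →L[𝕜] H}

/-- The operators `U(t,s)` with `s ≤ t` in `I` are bounded by a common constant. -/
def IsUniformlyBounded (I : Set ℝ) (U : ℝ → ℝ → H →L[𝕜] H) : Prop :=
  ∃ M ≥ (0 : ℝ), ∀ s ∈ I, ∀ t ∈ I, s ≤ t → ‖U t s‖ ≤ M

lemma IsUniformlyBounded.mono (hU : IsUniformlyBounded I U) (hJ : J ⊆ I) :
    IsUniformlyBounded J U :=
  hU.imp fun _ hM => ⟨hM.1, fun s hs t ht => hM.2 s (hJ hs) t (hJ ht)⟩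

lemma IsExponentiallyStable.isUniformlyBounded (hU : IsExponentiallyStable U) :
    IsUniformlyBounded (Ici 0) U := by
  obtain ⟨M, hM0, α, hα, hM⟩ := hU
  exact ⟨M, hM0, fun s hs t _ hst => (hM s t hs hst).trans
    (mul_le_of_le_one_right hM0 (exp_neg_mul_le_one hα.le (sub_nonneg.2 hst)))⟩

namespace IsEvolutionOperator

lemma mono (hU : IsEvolutionOperator I U) (hJ : J ⊆ I) : IsEvolutionOperator J U where
  refl t ht := hU.refl t (hJ ht)
  comp s hs r hr t ht := hU.comp s (hJ hs) r (hJ hr) t (hJ ht)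
  continuousOn_left s hs x :=
    (hU.continuousOn_left s (hJ hs) x).mono (inter_subset_inter_left _ hJ)
  continuousOn_right t ht x :=
    (hU.continuousOn_right t (hJ ht) x).mono (inter_subset_inter_left _ hJ)

lemma comp_apply (hU : IsEvolutionOperator I U) {s r t : ℝ} (hs : s ∈ I) (hr : r ∈ I)
    (ht : t ∈ I) (hsr : s ≤ r) (hrt : r ≤ t) (x : H) : U t r (U r s x) = U t s x :=
  DFunLike.congr_fun (hU.comp s hs r hr t ht hsr hrt) x

lemma continuousOn_Icc_left (hU : IsEvolutionOperator (Icc a b) U) (hab : a ≤ b) (x : H) :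
    ContinuousOn (fun t => U t a x) (Icc a b) :=
  (hU.continuousOn_left a (left_mem_Icc.2 hab) x).mono fun _ ht => ⟨ht, ht.1⟩

lemma continuousOn_Icc_right (hU : IsEvolutionOperator (Icc a b) U) (hab : a ≤ b) (x : H) :
    ContinuousOn (fun s => U b s x) (Icc a b) :=
  (hU.continuousOn_right b (right_mem_Icc.2 hab) x).mono fun _ hs => ⟨hs, hs.2⟩

lemma memLp_top_left (hU : IsEvolutionOperator (Icc a b) U) (hab : a ≤ b) (x : H) :
    MemLp (fun t => U t a x) ⊤ (volume.restrict (Icc a b)) :=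
  memLp_top_of_continuousOn_isCompact isCompact_Icc (hU.continuousOn_Icc_left hab x)

lemma isStronglyEssBounded_right [CompleteSpace H] (hU : IsEvolutionOperator (Icc a b) U)
    (hab : a ≤ b) : IsStronglyEssBounded (volume.restrict (Icc a b)) (fun s => U b s) :=
  .of_forall_continuousOn_apply isCompact_Icc (hU.continuousOn_Icc_right hab)

/- Strong continuity holds only in each variable separately and only for `s ≤ t`; extending `U`
from the triangle to the plane makes the measurability of Carathéodory functions applicable. -/
lemma stronglyMeasurable_projIcc (hU : IsEvolutionOperator (Icc a b) U) (hab : a ≤ b) (x : H) :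
    StronglyMeasurable fun p : ℝ × ℝ =>
      U (max (projIcc a b hab p.1) (projIcc a b hab p.2)) (projIcc a b hab p.2) x := by
  let π : ℝ → ℝ := fun r => projIcc a b hab r
  have hπ : Continuous π := continuous_subtype_val.comp continuous_projIcc
  have hπ_mem : ∀ r, π r ∈ Icc a b := fun r => (projIcc a b hab r).2
  refine stronglyMeasurable_uncurry_of_continuous_of_stronglyMeasurable
    (u := fun ρ r => U (max (π ρ) (π r)) (π r) x) (fun r => ?_) (fun ρ => ?_)
  · exact (hU.continuousOn_left _ (hπ_mem r) x).comp_continuous (hπ.max continuous_const) fun ρ =>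
      ⟨⟨(hπ_mem r).1.trans (le_max_right _ _), max_le (hπ_mem ρ).2 (hπ_mem r).2⟩,
        mem_Ici.2 (le_max_right _ _)⟩
  · have hcont : Continuous fun r => U (π ρ) (min (π r) (π ρ)) x :=
      (hU.continuousOn_right _ (hπ_mem ρ) x).comp_continuous (hπ.min continuous_const) fun r =>
        ⟨⟨le_min (hπ_mem r).1 (hπ_mem ρ).1, (min_le_left _ _).trans (hπ_mem r).2⟩,
          mem_Iic.2 (min_le_right _ _)⟩
    have hite : StronglyMeasurable fun r =>
        if π r ≤ π ρ then U (π ρ) (min (π r) (π ρ)) x else x :=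
      hcont.stronglyMeasurable.ite (measurableSet_le hπ.measurable measurable_const)
        stronglyMeasurable_const
    convert hite using 2 with r
    split_ifs with hr
    · rw [max_eq_left hr, min_eq_left hr]
    · rw [max_eq_right (not_le.1 hr).le, hU.refl _ (hπ_mem r), ContinuousLinearMap.id_apply]

lemma isStronglyEssBounded_triangle (hU : IsEvolutionOperator (Icc a b) U)
    (hU_bdd : IsUniformlyBounded (Icc a b) U) (hab : a ≤ b) :
    IsStronglyEssBounded ((volume.restrict (Icc a b)).prod (volume.restrict (Icc a b)))
      ({p : ℝ × ℝ | p.2 ≤ p.1}.indicator fun p => U p.1 p.2) := by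
  obtain ⟨M, hM0, hM⟩ := hU_bdd
  have hmem : ∀ᵐ p : ℝ × ℝ ∂(volume.restrict (Icc a b)).prod (volume.restrict (Icc a b)),
      p ∈ Icc a b ×ˢ Icc a b := by
    rw [Measure.prod_restrict]
    exact ae_restrict_mem (measurableSet_Icc.prod measurableSet_Icc)
  refine ⟨fun x => ?_, M, ?_⟩
  · refine ((hU.stronglyMeasurable_projIcc hab x).indicator
      (measurableSet_le measurable_snd measurable_fst)).aestronglyMeasurable.congr ?_
    filter_upwards [hmem] with p hp
    by_cases h : p ∈ {p : ℝ × ℝ | p.2 ≤ p.1}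
    · rw [indicator_of_mem h, indicator_of_mem h, projIcc_of_mem hab hp.1, projIcc_of_mem hab hp.2,
        max_eq_left h]
    · rw [indicator_of_notMem h, indicator_of_notMem h, zero_apply]
  · filter_upwards [hmem] with p hp
    by_cases h : p ∈ {p : ℝ × ℝ | p.2 ≤ p.1}
    · rw [indicator_of_mem h]
      exact hM _ hp.2 _ hp.1 h
    · rwa [indicator_of_notMem h, norm_zero]

lemma memLp_top_triangle (hU : IsEvolutionOperator (Icc a b) U)
    (hU_bdd : IsUniformlyBounded (Icc a b) U) (hab : a ≤ b) {f : ℝ → H}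
    (hf : MemLp f ⊤ (volume.restrict (Icc a b))) :
    MemLp ({p : ℝ × ℝ | p.2 ≤ p.1}.indicator fun p => U p.1 p.2 (f p.2)) ⊤
      ((volume.restrict (Icc a b)).prod (volume.restrict (Icc a b))) := by
  convert (hU.isStronglyEssBounded_triangle hU_bdd hab).memLp_apply (hf.comp_snd _) using 2 with p
  by_cases h : p ∈ {p : ℝ × ℝ | p.2 ≤ p.1}
  · rw [indicator_of_mem h, indicator_of_mem h]
  · rw [indicator_of_notMem h, indicator_of_notMem h, zero_apply]

variable [NormedSpace ℝ H]

lemma exists_bound_integral (hU_bdd : IsUniformlyBounded (Icc a b) U) {f : ℝ → H}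
    (hf : MemLp f ⊤ (volume.restrict (Icc a b))) :
    ∃ C, ∀ ρ ∈ Icc a b, ‖∫ r in a..ρ, U ρ r (f r)‖ ≤ C := by
  obtain ⟨M, hM0, hM⟩ := hU_bdd
  refine ⟨M * ∫ r in Icc a b, ‖f r‖, fun ρ hρ => ?_⟩
  have hf_int : IntegrableOn (fun r => ‖f r‖) (Icc a b) := (hf.integrable le_top).norm
  calc ‖∫ r in a..ρ, U ρ r (f r)‖ ≤ ∫ r in a..ρ, M * ‖f r‖ := by
        refine intervalIntegral.norm_integral_le_of_norm_le hρ.1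
          (Filter.Eventually.of_forall fun r hr => (U ρ r).le_of_opNorm_le
            (hM r ⟨hr.1.le, hr.2.trans hρ.2⟩ ρ hρ hr.2) (f r)) ?_
        exact (intervalIntegrable_iff_integrableOn_Icc_of_le hρ.1).2
          ((hf_int.mono_set (Icc_subset_Icc_right hρ.2)).const_mul M)
    _ ≤ M * ∫ r in Icc a b, ‖f r‖ := by
        rw [intervalIntegral.integral_const_mul, intervalIntegral.integral_of_le hρ.1,
          ← integral_Icc_eq_integral_Ioc]
        exact mul_le_mul_of_nonneg_left (setIntegral_mono_set hf_int
          (Filter.Eventually.of_forall fun r => norm_nonneg _)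
          (Icc_subset_Icc_right hρ.2).eventuallyLE) hM0

lemma memLp_top_integral (hU : IsEvolutionOperator (Icc a b) U)
    (hU_bdd : IsUniformlyBounded (Icc a b) U) (hab : a ≤ b) {f : ℝ → H}
    (hf : MemLp f ⊤ (volume.restrict (Icc a b))) :
    MemLp (fun ρ => ∫ r in a..ρ, U ρ r (f r)) ⊤ (volume.restrict (Icc a b)) := by
  obtain ⟨C, hC⟩ := exists_bound_integral hU_bdd hf
  refine memLp_top_of_bound ?_ C (ae_restrict_of_forall_mem measurableSet_Icc hC)
  refine (hU.memLp_top_triangle hU_bdd hab hf).aestronglyMeasurable.integral_prod_right'.congr ?_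
  filter_upwards [ae_restrict_mem measurableSet_Icc] with ρ hρ
  exact setIntegral_Icc_indicator_Iic hρ fun r => U ρ r (f r)

variable [CompleteSpace H]

lemma integral_triangle_swap [NormedSpace ℝ F] [CompleteSpace F]
    (hU : IsEvolutionOperator (Icc a b) U) (hU_bdd : IsUniformlyBounded (Icc a b) U)
    (hab : a ≤ b) {A : ℝ → H →L[𝕜] F} (hA : IsStronglyEssBounded (volume.restrict (Icc a b)) A)
    {f : ℝ → H} (hf : MemLp f ⊤ (volume.restrict (Icc a b))) :
    ∫ ρ in a..b, A ρ (∫ r in a..ρ, U ρ r (f r)) = ∫ r in a..b, ∫ ρ in r..b, A ρ (U ρ r (f r)) := by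
  have hk : Integrable ({p : ℝ × ℝ | p.2 ≤ p.1}.indicator fun p => A p.1 (U p.1 p.2 (f p.2)))
      ((volume.restrict (Icc a b)).prod (volume.restrict (Icc a b))) := by
    convert (hA.comp_fst.memLp_apply (hU.memLp_top_triangle hU_bdd hab hf)).integrable le_top
      using 2 with p
    by_cases h : p ∈ {p : ℝ × ℝ | p.2 ≤ p.1}
    · rw [indicator_of_mem h, indicator_of_mem h]
    · rw [indicator_of_notMem h, indicator_of_notMem h, map_zero]
  rw [← intervalIntegral_triangle_swap hab hk]
  refine intervalIntegral.integral_congr fun ρ hρ => ?_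
  rw [uIcc_of_le hab] at hρ
  have hsub : Icc a ρ ⊆ Icc a b := Icc_subset_Icc_right hρ.2
  exact ((A ρ).intervalIntegral_comp_comm (intervalIntegrable_of_memLp_top hρ.1
    (((hU.mono hsub).isStronglyEssBounded_right hρ.1).memLp_apply
      (hf.mono_measure (Measure.restrict_mono_set volume hsub))))).symm

end IsEvolutionOperator

end EvolutionProperties

section Perturbation

variable {𝕜 : Type*} [RCLike 𝕜]
  {H : Type*} [NormedAddCommGroup H] [InnerProductSpace 𝕜 H] [NormedSpace ℝ H]
  {I J : Set ℝ} {a b : ℝ} {Y V : ℝ → ℝ → H →L[𝕜] H} {D : ℝ → H →L[𝕜] H}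

lemma IsPerturbedEvolutionOperator.mono (h : IsPerturbedEvolutionOperator I Y D V) (hJ : J ⊆ I) :
    IsPerturbedEvolutionOperator J Y D V where
  evolution := h.evolution.mono hJ
  integrable s hs t ht := h.integrable s (hJ hs) t (hJ ht)
  eq s hs t ht := h.eq s (hJ hs) t (hJ ht)

lemma eqOn_zero_of_eq_integral (hY_bdd : IsUniformlyBounded (Icc a b) Y)
    (hD : IsStronglyEssBounded (volume.restrict (Icc a b)) D) {e : ℝ → H}
    (he : MemLp e ⊤ (volume.restrict (Icc a b)))
    (he_eq : ∀ t ∈ Icc a b, e t = ∫ r in a..t, Y t r (D r (e r))) {t : ℝ} (ht : t ∈ Icc a b) :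
    e t = 0 := by
  obtain ⟨C, hC⟩ := IsEvolutionOperator.exists_bound_integral hY_bdd (hD.memLp_apply he)
  obtain ⟨M, hM0, hM⟩ := hY_bdd
  obtain ⟨c, hc⟩ := hD.exists_bound
  have hnorm := le_exp_of_forall_majorant_le_add_integral (f := fun r => ‖e r‖) (C := M * |c|)
    le_rfl (by positivity) (fun t ht => by rw [he_eq t ht]; exact hC t ht)
    (fun g hg _ hfg t ht => by
      rw [he_eq t ht, zero_add]
      refine norm_intervalIntegral_le_mul_integral ht.1 hg ?_
      filter_upwards [ae_mono (Measure.restrict_mono_set volume (Icc_subset_Icc_right ht.2)) hc,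
        ae_restrict_mem measurableSet_Icc] with r hcr hr
      have hr' : r ∈ Icc a b := ⟨hr.1, hr.2.trans ht.2⟩
      rw [mul_assoc]
      exact (Y t r).le_of_opNorm_le_of_le (hM r hr' t ht hr.2)
        ((D r).le_of_opNorm_le_of_le (hcr.trans (le_abs_self c)) (hfg r hr'))) ht
  rwa [mul_zero, zero_mul, norm_le_zero_iff] at hnorm

variable [CompleteSpace H]

lemma IsPerturbedEvolutionOperator.isUniformlyBounded_unperturbed
    (hY : IsEvolutionOperator (Icc a b) Y) (h : IsPerturbedEvolutionOperator (Icc a b) Y D V)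
    (hD : ∃ c, ∀ᵐ r ∂volume.restrict (Icc a b), ‖D r‖ ≤ c)
    (hV_bdd : IsUniformlyBounded (Icc a b) V) : IsUniformlyBounded (Icc a b) Y := by
  obtain ⟨M, hM0, hM⟩ := hV_bdd
  obtain ⟨c, hc⟩ := hD
  refine ⟨2 * M * Real.exp ((2 * (|c| * M) + 1) * (b - a)), by positivity, fun s hs t ht hst => ?_⟩
  have hsub : Icc a t ⊆ Icc a b := Icc_subset_Icc_right ht.2
  obtain ⟨C, hC⟩ := exists_bound_of_forall_continuousOn_apply isCompact_Icc
    ((hY.mono hsub).continuousOn_Icc_right ht.1)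
  refine (le_exp_of_forall_majorant_le_add_integral_right (f := fun s => ‖Y t s‖) (C := |c| * M) hM0
    (by positivity) hC (fun g hg hg0 hfg s hs => ?_) ⟨hs.1, hst⟩).trans ?_
  · have hg_int : 0 ≤ ∫ r in s..t, g r := intervalIntegral.integral_nonneg hs.2 fun r _ => hg0 r
    refine ContinuousLinearMap.opNorm_le_bound _ (by positivity) fun w => ?_
    rw [eq_sub_of_add_eq (h.eq s (hsub hs) t ht hs.2 w).symm]
    have hint : ‖∫ r in s..t, Y t r (D r (V r s w))‖ ≤ |c| * M * ‖w‖ * ∫ r in s..t, g r := by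
      refine norm_intervalIntegral_le_mul_integral hs.2 hg ?_
      filter_upwards [ae_mono (Measure.restrict_mono_set volume (Icc_subset_Icc hs.1 ht.2)) hc,
        ae_restrict_mem measurableSet_Icc] with r hcr hr
      calc ‖Y t r (D r (V r s w))‖ ≤ g r * (|c| * (M * ‖w‖)) :=
            (Y t r).le_of_opNorm_le_of_le (hfg r ⟨hs.1.trans hr.1, hr.2⟩)
              ((D r).le_of_opNorm_le_of_le (hcr.trans (le_abs_self c)) ((V r s).le_of_opNorm_le
                (hM s (hsub hs) r (hsub ⟨hs.1.trans hr.1, hr.2⟩) hr.1) w))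
        _ = |c| * M * ‖w‖ * g r := by ring
    linarith [norm_sub_le (V t s w) (∫ r in s..t, Y t r (D r (V r s w))),
      (V t s).le_of_opNorm_le (hM s (hsub hs) t ht hs.2) w]
  · gcongr
    exacts [ht.2, hs.1]

lemma IsPerturbedEvolutionOperator.isUniformlyBounded
    (h : IsPerturbedEvolutionOperator (Icc a b) Y D V)
    (hD : ∃ c, ∀ᵐ r ∂volume.restrict (Icc a b), ‖D r‖ ≤ c)
    (hY_bdd : IsUniformlyBounded (Icc a b) Y) : IsUniformlyBounded (Icc a b) V := by
  obtain ⟨M, hM0, hM⟩ := hY_bdd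
  obtain ⟨c, hc⟩ := hD
  refine ⟨2 * M * Real.exp ((2 * (M * |c|) + 1) * (b - a)), by positivity, fun s hs t ht hst => ?_⟩
  have hsub : Icc s b ⊆ Icc a b := Icc_subset_Icc_left hs.1
  obtain ⟨C, hC⟩ := exists_bound_of_forall_continuousOn_apply isCompact_Icc
    ((h.evolution.mono hsub).continuousOn_Icc_left hs.2)
  refine (le_exp_of_forall_majorant_le_add_integral (f := fun t => ‖V t s‖) (C := M * |c|) hM0
    (by positivity) hC (fun g hg hg0 hfg t ht => ?_) ⟨hst, ht.2⟩).trans ?_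
  · have hg_int : 0 ≤ ∫ r in s..t, g r := intervalIntegral.integral_nonneg ht.1 fun r _ => hg0 r
    refine ContinuousLinearMap.opNorm_le_bound _ (by positivity) fun w => ?_
    rw [h.eq s hs t (hsub ht) ht.1 w]
    have hint : ‖∫ r in s..t, Y t r (D r (V r s w))‖ ≤ M * |c| * ‖w‖ * ∫ r in s..t, g r := by
      refine norm_intervalIntegral_le_mul_integral ht.1 hg ?_
      filter_upwards [ae_mono (Measure.restrict_mono_set volume (Icc_subset_Icc hs.1 ht.2)) hc,
        ae_restrict_mem measurableSet_Icc] with r hcr hr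
      have hr' : r ∈ Icc s b := ⟨hr.1, hr.2.trans ht.2⟩
      calc ‖Y t r (D r (V r s w))‖ ≤ M * (|c| * (g r * ‖w‖)) :=
            (Y t r).le_of_opNorm_le_of_le (hM r (hsub hr') t (hsub ht) hr.2)
              ((D r).le_of_opNorm_le_of_le (hcr.trans (le_abs_self c))
                ((V r s).le_of_opNorm_le (hfg r hr') w))
        _ = M * |c| * ‖w‖ * g r := by ring
    linarith [norm_add_le (Y t s w) (∫ r in s..t, Y t r (D r (V r s w))),
      (Y t s).le_of_opNorm_le (hM s hs t (hsub ht) ht.1) w]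
  · gcongr
    exacts [ht.2, hs.1]

lemma IsPerturbedEvolutionOperator.integral_eq_add_integral (hab : a ≤ b)
    (hY : IsEvolutionOperator (Icc a b) Y) (h : IsPerturbedEvolutionOperator (Icc a b) Y D V)
    (hV_bdd : IsUniformlyBounded (Icc a b) V)
    (hD : IsStronglyEssBounded (volume.restrict (Icc a b)) D) {g : ℝ → H}
    (hg : MemLp g ⊤ (volume.restrict (Icc a b))) :
    ∫ r in a..b, V b r (g r) =
      (∫ r in a..b, Y b r (g r)) + ∫ r in a..b, Y b r (D r (∫ σ in a..r, V r σ (g σ))) := by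
  have hYb := hY.isStronglyEssBounded_right hab
  have swap : ∫ ρ in a..b, Y b ρ (D ρ (∫ r in a..ρ, V ρ r (g r))) =
      ∫ r in a..b, ∫ ρ in r..b, Y b ρ (D ρ (V ρ r (g r))) :=
    h.evolution.integral_triangle_swap hV_bdd hab (hYb.comp hD) hg
  have hVg := intervalIntegrable_of_memLp_top hab
    ((h.evolution.isStronglyEssBounded_right hab).memLp_apply hg)
  have hYg := intervalIntegrable_of_memLp_top hab (hYb.memLp_apply hg)
  rw [swap, ← sub_eq_iff_eq_add', ← intervalIntegral.integral_sub hVg hYg]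
  refine intervalIntegral.integral_congr fun r hr => ?_
  rw [uIcc_of_le hab] at hr
  exact sub_eq_of_eq_add' (h.eq r hr b (right_mem_Icc.2 hab) hr.2 (g r))

/- The difference of the two sides solves the homogeneous Volterra equation of `D₁`. -/
lemma IsPerturbedEvolutionOperator.apply_eq_add_integral {V₁ V₂ : ℝ → ℝ → H →L[𝕜] H}
    {D₁ D₂ : ℝ → H →L[𝕜] H} (hY : IsEvolutionOperator (Icc a b) Y)
    (h₁ : IsPerturbedEvolutionOperator (Icc a b) Y D₁ V₁)
    (h₂ : IsPerturbedEvolutionOperator (Icc a b) Y D₂ V₂)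
    (hY_bdd : IsUniformlyBounded (Icc a b) Y)
    (hD₁ : IsStronglyEssBounded (volume.restrict (Icc a b)) D₁)
    (hD₂ : IsStronglyEssBounded (volume.restrict (Icc a b)) D₂) {t : ℝ} (ht : t ∈ Icc a b) (x : H) :
    V₂ t a x = V₁ t a x + ∫ r in a..t, V₁ t r ((D₂ r - D₁ r) (V₂ r a x)) := by
  have hab : a ≤ b := ht.1.trans ht.2
  have hV₁_bdd := h₁.isUniformlyBounded hD₁.exists_bound hY_bdd
  have hV₁ := h₁.evolution.memLp_top_left hab x
  have hV₂ := h₂.evolution.memLp_top_left hab x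
  have hg := (hD₂.sub hD₁).memLp_apply hV₂
  set g : ℝ → H := fun r => (D₂ r - D₁ r) (V₂ r a x) with g_def
  set ξ : ℝ → H := fun τ => ∫ r in a..τ, V₁ τ r (g r)
  have hξ := h₁.evolution.memLp_top_integral hV₁_bdd hab hg
  have he := eqOn_zero_of_eq_integral (e := fun τ => V₂ τ a x - V₁ τ a x - ξ τ) hY_bdd hD₁
    ((hV₂.sub hV₁).sub hξ) (fun τ hτ => ?_) ht
  · rwa [sub_sub, sub_eq_zero] at he
  have hsub : Icc a τ ⊆ Icc a b := Icc_subset_Icc_right hτ.2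
  have ha : a ∈ Icc a b := left_mem_Icc.2 hab
  have hrestrict := Measure.restrict_mono_set volume hsub
  have intervalIntegrable_Y : ∀ {f : ℝ → H}, MemLp f ⊤ (volume.restrict (Icc a b)) →
      IntervalIntegrable (fun r => Y τ r (D₁ r (f r))) volume a τ := fun hf =>
    intervalIntegrable_of_memLp_top hτ.1
      (((hY.mono hsub).isStronglyEssBounded_right hτ.1).memLp_apply
        ((hD₁.memLp_apply hf).mono_measure hrestrict))
  have ξ_eq : ξ τ = (∫ r in a..τ, Y τ r (g r)) + ∫ r in a..τ, Y τ r (D₁ r (ξ r)) :=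
    (h₁.mono hsub).integral_eq_add_integral hτ.1 (hY.mono hsub) (hV₁_bdd.mono hsub)
      (hD₁.mono_measure hrestrict) (hg.mono_measure hrestrict)
  have integral_g : ∫ r in a..τ, Y τ r (g r) =
      (∫ r in a..τ, Y τ r (D₂ r (V₂ r a x))) - ∫ r in a..τ, Y τ r (D₁ r (V₂ r a x)) := by
    rw [← intervalIntegral.integral_sub (h₂.integrable a ha τ hτ hτ.1 x) (intervalIntegrable_Y hV₂)]
    simp only [g_def, sub_apply, map_sub]
  simp only [map_sub]
  rw [intervalIntegral.integral_sub ((intervalIntegrable_Y hV₂).sub (intervalIntegrable_Y hV₁))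
      (intervalIntegrable_Y hξ), intervalIntegral.integral_sub (intervalIntegrable_Y hV₂)
      (intervalIntegrable_Y hV₁), ξ_eq, integral_g, h₁.eq a ha τ hτ hτ.1 x, h₂.eq a ha τ hτ hτ.1 x]
  abel

end Perturbation

section Lyapunov

lemma norm_mul_mul_sub_star_le {A : Type*} [NonUnitalNormedRing A] [StarRing A]
    [NormedStarGroup A] {n : A} (hn : IsSelfAdjoint n) (p : A) :
    ‖p * (n * p) - star (p * (n * p))‖ ≤ 2 * ‖n‖ * ‖p‖ * ‖p - star p‖ := by
  have hsplit : p * (n * p) - star (p * (n * p)) =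
      (p - star p) * (n * p) + star p * (n * (p - star p)) := by
    rw [star_mul, star_mul, hn.star_eq]
    noncomm_ring
  calc ‖p * (n * p) - star (p * (n * p))‖
      ≤ ‖p - star p‖ * (‖n‖ * ‖p‖) + ‖star p‖ * (‖n‖ * ‖p - star p‖) := by
        rw [hsplit]
        exact norm_add_le_of_le
          ((norm_mul_le _ _).trans (mul_le_mul_of_nonneg_left (norm_mul_le _ _) (norm_nonneg _)))
          ((norm_mul_le _ _).trans (mul_le_mul_of_nonneg_left (norm_mul_le _ _) (norm_nonneg _)))
    _ = 2 * ‖n‖ * ‖p‖ * ‖p - star p‖ := by rw [norm_star]; ring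

variable {𝕜 : Type*} [RCLike 𝕜]
  {H : Type*} [NormedAddCommGroup H] [InnerProductSpace 𝕜 H]
  {a b s : ℝ} {V : ℝ → ℝ → H →L[𝕜] H} {P₀ : H →L[𝕜] H} {Q P : ℝ → H →L[𝕜] H}

lemma norm_inner_apply_apply_le {U A : H →L[𝕜] H} {M C : ℝ} (hU : ‖U‖ ≤ M) (hA : ‖A‖ ≤ C)
    (x y : H) : ‖⟪U y, A (U x)⟫_𝕜‖ ≤ M ^ 2 * C * ‖x‖ * ‖y‖ := by
  have hM : 0 ≤ M := (norm_nonneg U).trans hU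
  calc ‖⟪U y, A (U x)⟫_𝕜‖ ≤ ‖U y‖ * ‖A (U x)‖ := norm_inner_le_norm _ _
    _ ≤ (M * ‖y‖) * (C * (M * ‖x‖)) :=
        mul_le_mul (U.le_of_opNorm_le hU y) (A.le_of_opNorm_le_of_le hA (U.le_of_opNorm_le hU x))
          (norm_nonneg _) (by positivity)
    _ = M ^ 2 * C * ‖x‖ * ‖y‖ := by ring

/-- `P` is a mild solution on `[a,b]` of the Lyapunov equation `-P' = A*P + PA + Q`, `P(b) = P₀`,
where `A(t)` generates the evolution operator `V`; that is,
`P(s) = V(b,s)* P₀ V(b,s) + ∫ₛᵇ V(r,s)* Q(r) V(r,s) dr`, in the weak sense. -/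
def IsLyapunovSolution (a b : ℝ) (V : ℝ → ℝ → H →L[𝕜] H) (P₀ : H →L[𝕜] H) (Q P : ℝ → H →L[𝕜] H) :
    Prop :=
  ∀ s ∈ Icc a b, ∀ x y : H,
    ⟪y, P s x⟫_𝕜 = ⟪V b s y, P₀ (V b s x)⟫_𝕜 + ∫ r in s..b, ⟪V r s y, Q r (V r s x)⟫_𝕜

lemma IsEvolutionOperator.intervalIntegrable_inner_apply
    (hV : IsEvolutionOperator (Icc a b) V) (hQ : IsStronglyEssBounded (volume.restrict (Icc a b)) Q)
    (hs : s ∈ Icc a b) (x y : H) :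
    IntervalIntegrable (fun r => ⟪V r s y, Q r (V r s x)⟫_𝕜) volume s b := by
  have hsub : Icc s b ⊆ Icc a b := Icc_subset_Icc_left hs.1
  have hVs := (hV.mono hsub).memLp_top_left hs.2
  exact intervalIntegrable_of_memLp_top hs.2 (memLp_top_inner (hVs y)
    ((hQ.mono_measure (Measure.restrict_mono_set volume hsub)).memLp_apply (hVs x)))

namespace IsLyapunovSolution

lemma mono_left (h : IsLyapunovSolution a b V P₀ Q P) (hs : a ≤ s) :
    IsLyapunovSolution s b V P₀ Q P :=
  fun r hr => h r ⟨hs.trans hr.1, hr.2⟩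

lemma norm_le (h : IsLyapunovSolution a b V P₀ Q P) (hs : s ∈ Icc a b) {M C : ℝ} {g : ℝ → ℝ}
    (hM : ∀ r ∈ Icc s b, ‖V r s‖ ≤ M) (hg : Continuous g)
    (hQ : ∀ᵐ r ∂volume.restrict (Icc s b), ‖Q r‖ ≤ C * g r) :
    ‖P s‖ ≤ M ^ 2 * (‖P₀‖ + C * ∫ r in s..b, g r) := by
  have hint_nonneg : 0 ≤ C * ∫ r in s..b, g r :=
    (norm_nonneg (∫ r in s..b, ‖Q r‖)).trans
      (norm_intervalIntegral_le_mul_integral hs.2 hg (by simpa only [norm_norm] using hQ))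
  refine opNorm_le_of_norm_inner_le (by positivity) fun x y => ?_
  have hterminal := norm_inner_apply_apply_le (A := P₀) (hM b (right_mem_Icc.2 hs.2)) le_rfl x y
  have hrunning : ‖∫ r in s..b, ⟪V r s y, Q r (V r s x)⟫_𝕜‖ ≤
      M ^ 2 * C * ‖x‖ * ‖y‖ * ∫ r in s..b, g r := by
    refine norm_intervalIntegral_le_mul_integral hs.2 hg ?_
    filter_upwards [hQ, ae_restrict_mem measurableSet_Icc] with r hQr hr
    exact (norm_inner_apply_apply_le (hM r hr) hQr x y).trans_eq (by ring)
  rw [h s hs x y]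
  exact (norm_add_le_of_le hterminal hrunning).trans_eq (by ring)

lemma exists_bound (h : IsLyapunovSolution a b V P₀ Q P) (hV_bdd : IsUniformlyBounded (Icc a b) V)
    (hQ : ∃ c, ∀ᵐ r ∂volume.restrict (Icc a b), ‖Q r‖ ≤ c) : ∃ C, ∀ s ∈ Icc a b, ‖P s‖ ≤ C := by
  obtain ⟨M, -, hM⟩ := hV_bdd
  obtain ⟨c, hc⟩ := hQ
  refine ⟨M ^ 2 * (‖P₀‖ + |c| * (b - a)), fun s hs => ?_⟩
  have hPs := h.norm_le (C := |c|) (g := fun _ => 1) hs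
    (fun r hr => hM s hs r ⟨hs.1.trans hr.1, hr.2⟩ hr.1) continuous_const (by
      filter_upwards [ae_mono (Measure.restrict_mono_set volume (Icc_subset_Icc_left hs.1)) hc]
        with r hr
      rw [mul_one]
      exact hr.trans (le_abs_self c))
  rw [integral_one] at hPs
  refine hPs.trans ?_
  gcongr
  exact hs.1

section SelfAdjoint

variable [CompleteSpace H]

lemma sub_adjoint (h : IsLyapunovSolution a b V P₀ Q P) (hV : IsEvolutionOperator (Icc a b) V)
    (hQ : IsStronglyEssBounded (volume.restrict (Icc a b)) Q) :
    IsLyapunovSolution a b V (P₀ - P₀.adjoint) (fun r => Q r - (Q r).adjoint)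
      (fun s => P s - (P s).adjoint) := by
  have inner_sub_adjoint (A : H →L[𝕜] H) (x y : H) :
      ⟪y, (A - A.adjoint) x⟫_𝕜 = ⟪y, A x⟫_𝕜 - (starRingEnd 𝕜) ⟪x, A y⟫_𝕜 := by
    rw [sub_apply, inner_sub_right, ContinuousLinearMap.adjoint_inner_right, inner_conj_symm]
  intro s hs x y
  have hint := hV.intervalIntegrable_inner_apply hQ hs
  simp only [inner_sub_adjoint]
  rw [intervalIntegral.integral_sub (hint x y) ?_, intervalIntegral.intervalIntegral_conj,
    h s hs x y, h s hs y x, map_add]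
  · ring
  · exact ⟨(RCLike.conjLIE (K := 𝕜)).integrable_comp_iff.2 (hint y x).1,
      (RCLike.conjLIE (K := 𝕜)).integrable_comp_iff.2 (hint y x).2⟩

/- The skew part `Δ = P - P*` solves the Lyapunov equation with right-hand side
`ΔNP + P*NΔ`, which is linear in `Δ`. -/
lemma isSelfAdjoint (h : IsLyapunovSolution a b V P₀ Q P) (hV : IsEvolutionOperator (Icc a b) V)
    (hV_bdd : IsUniformlyBounded (Icc a b) V)
    (hQ : IsStronglyEssBounded (volume.restrict (Icc a b)) Q) (hP₀ : IsSelfAdjoint P₀)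
    {W N : ℝ → H →L[𝕜] H} (hW : ∀ r ∈ Icc a b, IsSelfAdjoint (W r))
    (hN : ∀ r ∈ Icc a b, IsSelfAdjoint (N r)) (hN_bdd : ∃ n, ∀ r ∈ Icc a b, ‖N r‖ ≤ n)
    (hQ_eq : ∀ r ∈ Icc a b, Q r = W r + P r ∘L N r ∘L P r) (hs : s ∈ Icc a b) :
    IsSelfAdjoint (P s) := by
  obtain ⟨p, hp⟩ := h.exists_bound hV_bdd hQ.exists_bound
  obtain ⟨M, -, hM⟩ := hV_bdd
  obtain ⟨n, hn⟩ := hN_bdd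
  have hn0 : 0 ≤ n := (norm_nonneg _).trans (hn s hs)
  have hp0 : 0 ≤ p := (norm_nonneg _).trans (hp s hs)
  have hQ_skew : ∀ r ∈ Icc a b,
      ‖Q r - (Q r).adjoint‖ ≤ 2 * n * p * ‖P r - (P r).adjoint‖ := fun r hr => by
    have hskew := norm_mul_mul_sub_star_le (hN r hr) (P r)
    have hcancel : Q r - star (Q r) = P r * (N r * P r) - star (P r * (N r * P r)) := by
      rw [hQ_eq r hr, star_add, (hW r hr).star_eq]
      exact add_sub_add_left_eq_sub _ _ _
    rw [← hcancel] at hskew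
    refine hskew.trans (mul_le_mul_of_nonneg_right ?_ (norm_nonneg _))
    gcongr
    exacts [hn r hr, hp r hr]
  have hzero := le_exp_of_forall_majorant_le_add_integral_right
    (f := fun s => ‖P s - (P s).adjoint‖) (A := 0) (C := M ^ 2 * (2 * n * p)) (M := p + p) le_rfl
    (by positivity) (fun s hs => norm_sub_le_of_le (hp s hs) ?_) (fun g hg _ hfg s hs => ?_) hs
  · rw [mul_zero, zero_mul, norm_le_zero_iff, sub_eq_zero] at hzero
    exact hzero.symm
  · rw [LinearIsometryEquiv.norm_map]
    exact hp s hs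
  · refine ((h.sub_adjoint hV hQ).norm_le (C := 2 * n * p) hs
      (fun r hr => hM s hs r ⟨hs.1.trans hr.1, hr.2⟩ hr.1) hg ?_).trans_eq ?_
    · filter_upwards [ae_restrict_mem measurableSet_Icc] with r hr
      have hr' : r ∈ Icc a b := ⟨hs.1.trans hr.1, hr.2⟩
      exact (hQ_skew r hr').trans (mul_le_mul_of_nonneg_left (hfg r hr') (by positivity))
    · rw [← ContinuousLinearMap.star_eq_adjoint, hP₀.star_eq, sub_self, norm_zero]
      ring

end SelfAdjoint

section MildTrajectory

variable [NormedSpace ℝ H] [CompleteSpace H]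

lemma integral_inner_convolution (h : IsLyapunovSolution a b V P₀ Q P)
    (hV : IsEvolutionOperator (Icc a b) V) (hV_bdd : IsUniformlyBounded (Icc a b) V) (hab : a ≤ b)
    (hQ : IsStronglyEssBounded (volume.restrict (Icc a b)) Q)
    (hP : IsStronglyEssBounded (volume.restrict (Icc a b)) P) {f : ℝ → H}
    (hf : MemLp f ⊤ (volume.restrict (Icc a b))) (y : H) :
    ⟪V b a y, P₀ (∫ r in a..b, V b r (f r))⟫_𝕜 +
        ∫ ρ in a..b, ⟪V ρ a y, Q ρ (∫ r in a..ρ, V ρ r (f r))⟫_𝕜 =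
      ∫ r in a..b, ⟪V r a y, P r (f r)⟫_𝕜 := by
  have hVy := hV.memLp_top_left hab y
  have hVf := (hV.isStronglyEssBounded_right hab).memLp_apply hf
  have terminal_int : IntervalIntegrable (fun r => ⟪V b a y, P₀ (V b r (f r))⟫_𝕜) volume a b :=
    intervalIntegrable_of_memLp_top hab
      ((innerSL 𝕜 (V b a y) ∘L P₀).comp_memLp' hVf)
  have terminal : ⟪V b a y, P₀ (∫ r in a..b, V b r (f r))⟫_𝕜 =
      ∫ r in a..b, ⟪V b a y, P₀ (V b r (f r))⟫_𝕜 :=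
    ((innerSL 𝕜 (V b a y) ∘L P₀).intervalIntegral_comp_comm
      (intervalIntegrable_of_memLp_top hab hVf)).symm
  have swap : ∫ ρ in a..b, ⟪V ρ a y, Q ρ (∫ r in a..ρ, V ρ r (f r))⟫_𝕜 =
      ∫ r in a..b, ∫ ρ in r..b, ⟪V ρ a y, Q ρ (V ρ r (f r))⟫_𝕜 :=
    hV.integral_triangle_swap hV_bdd hab ((isStronglyEssBounded_innerSL hVy).comp hQ) hf
  rw [terminal, swap, ← eq_sub_iff_add_eq', ← intervalIntegral.integral_sub
    (intervalIntegrable_of_memLp_top hab (memLp_top_inner hVy (hP.memLp_apply hf))) terminal_int]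
  refine intervalIntegral.integral_congr fun r hr => ?_
  rw [uIcc_of_le hab] at hr
  have ha : a ∈ Icc a b := left_mem_Icc.2 hab
  have hVV : ∀ ρ ∈ Icc r b, V ρ r (V r a y) = V ρ a y := fun ρ hρ =>
    hV.comp_apply ha hr ⟨hr.1.trans hρ.1, hρ.2⟩ hr.1 hρ.1 y
  rw [h r hr, hVV b (right_mem_Icc.2 hr.2), add_sub_cancel_left]
  refine intervalIntegral.integral_congr fun ρ hρ => ?_
  rw [uIcc_of_le hr.2] at hρ
  rw [hVV ρ hρ]

lemma inner_mild_trajectory (h : IsLyapunovSolution a b V P₀ Q P)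
    (hV : IsEvolutionOperator (Icc a b) V) (hV_bdd : IsUniformlyBounded (Icc a b) V) (hab : a ≤ b)
    (hQ : IsStronglyEssBounded (volume.restrict (Icc a b)) Q)
    (hP : IsStronglyEssBounded (volume.restrict (Icc a b)) P) {f z : ℝ → H}
    (hf : MemLp f ⊤ (volume.restrict (Icc a b))) {x : H}
    (hz : ∀ t ∈ Icc a b, z t = V t a x + ∫ r in a..t, V t r (f r)) (y : H) :
    ⟪V b a y, P₀ (z b)⟫_𝕜 + ∫ r in a..b, ⟪V r a y, Q r (z r)⟫_𝕜 =
      ⟪y, P a x⟫_𝕜 + ∫ r in a..b, ⟪V r a y, P r (f r)⟫_𝕜 := by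
  have ha : a ∈ Icc a b := left_mem_Icc.2 hab
  have hconv : IntervalIntegrable (fun t => ⟪V t a y, Q t (∫ r in a..t, V t r (f r))⟫_𝕜)
      volume a b :=
    intervalIntegrable_of_memLp_top hab (memLp_top_inner (hV.memLp_top_left hab y)
      (hQ.memLp_apply (hV.memLp_top_integral hV_bdd hab hf)))
  have hrunning : ∫ r in a..b, ⟪V r a y, Q r (z r)⟫_𝕜 =
      (∫ r in a..b, ⟪V r a y, Q r (V r a x)⟫_𝕜) +
        ∫ t in a..b, ⟪V t a y, Q t (∫ r in a..t, V t r (f r))⟫_𝕜 := by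
    rw [← intervalIntegral.integral_add (hV.intervalIntegrable_inner_apply hQ ha x y) hconv]
    refine intervalIntegral.integral_congr fun t ht => ?_
    rw [uIcc_of_le hab] at ht
    simp only [hz t ht, map_add, inner_add_right]
  rw [← h.integral_inner_convolution hV hV_bdd hab hQ hP hf y, h a ha x y, hrunning,
    hz b (right_mem_Icc.2 hab), map_add, inner_add_right]
  ring

end MildTrajectory

end IsLyapunovSolution

end Lyapunov

section LinearQuadratic

variable {𝕜 : Type*} [RCLike 𝕜]
  {H : Type*} [NormedAddCommGroup H] [InnerProductSpace 𝕜 H]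
  {X : Type*} [NormedAddCommGroup X] [InnerProductSpace 𝕜 X]
  {I J : Set ℝ} {a b δ : ℝ} {B : ℝ → X →L[𝕜] H} {P₀ : H →L[𝕜] H} {W : ℝ → H →L[𝕜] H}
  {R : ℝ → X →L[𝕜] X} {z z' : ℝ → H} {u u' : ℝ → X}

/-- The symmetric bilinear form on pairs of a state trajectory and a control whose diagonal is the
cost `⟪z(b), P₀ z(b)⟫ + ∫ₐᵇ (⟪z, W z⟫ + ⟪u, R u⟫)` of the linear quadratic control problem on
`[a,b]`. -/
noncomputable def lqPairing (P₀ : H →L[𝕜] H) (W : ℝ → H →L[𝕜] H) (R : ℝ → X →L[𝕜] X) (a b : ℝ)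
    (z : ℝ → H) (u : ℝ → X) (z' : ℝ → H) (u' : ℝ → X) : ℝ :=
  RCLike.re ⟪z b, P₀ (z' b)⟫_𝕜 +
    ∫ r in a..b, (RCLike.re ⟪z r, W r (z' r)⟫_𝕜 + RCLike.re ⟪u r, R r (u' r)⟫_𝕜)

/-- The standing assumptions on the input operators `B`, the terminal weight `P₀`, the state
weights `W` and the control weights `R` of a linear quadratic control problem over the times in
`I`; `δ` is the coercivity constant of `R`. -/
structure IsLQData (I : Set ℝ) (B : ℝ → X →L[𝕜] H) (P₀ : H →L[𝕜] H) (W : ℝ → H →L[𝕜] H)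
    (R : ℝ → X →L[𝕜] X) (δ : ℝ) : Prop where
  continuousOn_input : ContinuousOn B I
  continuousOn_stateWeight : ContinuousOn W I
  continuousOn_controlWeight : ContinuousOn R I
  isPositive_terminalWeight : P₀.IsPositive
  isPositive_stateWeight : ∀ t ∈ I, (W t).IsPositive
  isSymmetric_controlWeight : ∀ t ∈ I, (R t).IsSymmetric
  coercivity_pos : 0 < δ
  coercive_controlWeight : ∀ t ∈ I, ∀ u : X, δ * ‖u‖ ^ 2 ≤ RCLike.re ⟪u, R t u⟫_𝕜

namespace IsLQData

lemma mono (hLQ : IsLQData I B P₀ W R δ) (hJ : J ⊆ I) : IsLQData J B P₀ W R δ where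
  continuousOn_input := hLQ.continuousOn_input.mono hJ
  continuousOn_stateWeight := hLQ.continuousOn_stateWeight.mono hJ
  continuousOn_controlWeight := hLQ.continuousOn_controlWeight.mono hJ
  isPositive_terminalWeight := hLQ.isPositive_terminalWeight
  isPositive_stateWeight t ht := hLQ.isPositive_stateWeight t (hJ ht)
  isSymmetric_controlWeight t ht := hLQ.isSymmetric_controlWeight t (hJ ht)
  coercivity_pos := hLQ.coercivity_pos
  coercive_controlWeight t ht := hLQ.coercive_controlWeight t (hJ ht)

lemma isPositive_controlWeight (hLQ : IsLQData I B P₀ W R δ) {t : ℝ} (ht : t ∈ I) :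
    (R t).IsPositive := by
  refine ⟨hLQ.isSymmetric_controlWeight t ht, fun u => ?_⟩
  rw [ContinuousLinearMap.reApplyInnerSelf_apply, inner_re_symm]
  exact (mul_nonneg hLQ.coercivity_pos.le (sq_nonneg _)).trans (hLQ.coercive_controlWeight t ht u)

lemma runningCost_nonneg (hLQ : IsLQData I B P₀ W R δ) {t : ℝ} (ht : t ∈ I) (x : H) (v : X) :
    0 ≤ RCLike.re ⟪x, W t x⟫_𝕜 + RCLike.re ⟪v, R t v⟫_𝕜 :=
  add_nonneg ((hLQ.isPositive_stateWeight t ht).re_inner_nonneg_right x)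
    ((hLQ.isPositive_controlWeight ht).re_inner_nonneg_right v)

section Integrability

variable [CompleteSpace H] [CompleteSpace X]

lemma intervalIntegrable_runningCost (hLQ : IsLQData (Icc a b) B P₀ W R δ) (hab : a ≤ b)
    (hz : MemLp z ⊤ (volume.restrict (Icc a b))) (hu : MemLp u ⊤ (volume.restrict (Icc a b)))
    (hz' : MemLp z' ⊤ (volume.restrict (Icc a b))) (hu' : MemLp u' ⊤ (volume.restrict (Icc a b))) :
    IntervalIntegrable
      (fun r => RCLike.re ⟪z r, W r (z' r)⟫_𝕜 + RCLike.re ⟪u r, R r (u' r)⟫_𝕜) volume a b := by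
  have hW : IsStronglyEssBounded (volume.restrict (Icc a b)) W :=
    .of_forall_continuousOn_apply isCompact_Icc fun x =>
      hLQ.continuousOn_stateWeight.clm_apply continuousOn_const
  have hR : IsStronglyEssBounded (volume.restrict (Icc a b)) R :=
    .of_forall_continuousOn_apply isCompact_Icc fun x =>
      hLQ.continuousOn_controlWeight.clm_apply continuousOn_const
  exact intervalIntegrable_of_memLp_top hab
    ((memLp_top_inner (𝕜 := 𝕜) hz (hW.memLp_apply hz')).re.add
      (memLp_top_inner (𝕜 := 𝕜) hu (hR.memLp_apply hu')).re)

lemma two_mul_lqPairing_le (hLQ : IsLQData (Icc a b) B P₀ W R δ) (hab : a ≤ b)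
    (hz : MemLp z ⊤ (volume.restrict (Icc a b))) (hu : MemLp u ⊤ (volume.restrict (Icc a b)))
    (hz' : MemLp z' ⊤ (volume.restrict (Icc a b))) (hu' : MemLp u' ⊤ (volume.restrict (Icc a b))) :
    2 * lqPairing P₀ W R a b z u z' u' ≤
      lqPairing P₀ W R a b z u z u + lqPairing P₀ W R a b z' u' z' u' := by
  have integrable_zz := hLQ.intervalIntegrable_runningCost hab hz hu hz hu
  have integrable_zz' := hLQ.intervalIntegrable_runningCost hab hz hu hz' hu'
  have integrable_z'z' := hLQ.intervalIntegrable_runningCost hab hz' hu' hz' hu'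
  have hrunning := intervalIntegral.integral_mono_on hab (integrable_zz'.const_mul 2)
    (integrable_zz.add integrable_z'z') fun r hr => by
      linarith [two_mul_re_inner_le_of_isPositive (hLQ.isPositive_stateWeight r hr) (z r) (z' r),
        two_mul_re_inner_le_of_isPositive (hLQ.isPositive_controlWeight hr) (u r) (u' r)]
  rw [intervalIntegral.integral_const_mul, intervalIntegral.integral_add integrable_zz
    integrable_z'z'] at hrunning
  have hterminal := two_mul_re_inner_le_of_isPositive hLQ.isPositive_terminalWeight (z b) (z' b)
  simp only [lqPairing]
  linarith

lemma integral_runningCost_le_lqPairing (hLQ : IsLQData (Icc a b) B P₀ W R δ) {t : ℝ}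
    (ht : t ∈ Icc a b) (hz : MemLp z ⊤ (volume.restrict (Icc a b)))
    (hu : MemLp u ⊤ (volume.restrict (Icc a b))) :
    ∫ r in a..t, (RCLike.re ⟪z r, W r (z r)⟫_𝕜 + RCLike.re ⟪u r, R r (u r)⟫_𝕜) ≤
      lqPairing P₀ W R a b z u z u := by
  refine (intervalIntegral.integral_mono_interval le_rfl ht.1 ht.2 ?_
    (hLQ.intervalIntegrable_runningCost (ht.1.trans ht.2) hz hu hz hu)).trans
    (le_add_of_nonneg_left (hLQ.isPositive_terminalWeight.re_inner_nonneg_right (z b)))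
  exact ae_restrict_of_forall_mem measurableSet_Ioc fun r hr =>
    hLQ.runningCost_nonneg (Ioc_subset_Icc_self hr) (z r) (u r)

lemma isSelfAdjoint_input_inverse_adjoint (hLQ : IsLQData I B P₀ W R δ) {t : ℝ} (ht : t ∈ I) :
    IsSelfAdjoint (B t ∘L (R t).inverse ∘L (B t).adjoint) := by
  refine IsSelfAdjoint.conj_adjoint ?_ (B t)
  have hR := hLQ.isSymmetric_controlWeight t ht
  have hinv := apply_inverse_of_coercive hLQ.coercivity_pos (hLQ.coercive_controlWeight t ht)
  refine ContinuousLinearMap.isSelfAdjoint_iff_isSymmetric.2 fun x y => ?_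
  calc ⟪(R t).inverse x, y⟫_𝕜 = ⟪(R t).inverse x, R t ((R t).inverse y)⟫_𝕜 := by rw [hinv]
    _ = ⟪R t ((R t).inverse x), (R t).inverse y⟫_𝕜 := (hR _ _).symm
    _ = ⟪x, (R t).inverse y⟫_𝕜 := by rw [hinv]

lemma continuousOn_inverse_adjoint (hLQ : IsLQData I B P₀ W R δ) :
    ContinuousOn (fun t => (R t).inverse ∘L (B t).adjoint) I :=
  (continuousOn_inverse_of_coercive hLQ.coercivity_pos hLQ.continuousOn_controlWeight
    hLQ.coercive_controlWeight).clm_comp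
    (ContinuousLinearMap.adjoint.continuous.comp_continuousOn hLQ.continuousOn_input)

end Integrability

end IsLQData

end LinearQuadratic

section Riccati

variable {𝕜 : Type*} [RCLike 𝕜]
  {H : Type*} [NormedAddCommGroup H] [InnerProductSpace 𝕜 H] [NormedSpace ℝ H] [CompleteSpace H]
  {X : Type*} [NormedAddCommGroup X] [InnerProductSpace 𝕜 X] [CompleteSpace X]
  {T δ s : ℝ} {Y V : ℝ → ℝ → H →L[𝕜] H} {B : ℝ → X →L[𝕜] H} {P₀ : H →L[𝕜] H}
  {W P : ℝ → H →L[𝕜] H} {R : ℝ → X →L[𝕜] X}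

namespace IsRiccatiSolution

lemma isLyapunovSolution (h : IsRiccatiSolution Y B P₀ W R T P V) :
    IsLyapunovSolution 0 T V P₀ (fun r => W r + P r ∘L B r ∘L riccatiFeedback B R P r) P := by
  intro s hs x y
  have hweak := (innerSL 𝕜 y).intervalIntegral_comp_comm (h.integrable s hs x)
  simp only [innerSL_apply_apply, ContinuousLinearMap.adjoint_inner_right] at hweak
  rw [h.eq s hs x, inner_add_right, ContinuousLinearMap.adjoint_inner_right, ← hweak]

lemma isStronglyEssBounded (h : IsRiccatiSolution Y B P₀ W R T P V) :
    IsStronglyEssBounded (volume.restrict (Icc 0 T)) P :=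
  ⟨h.bounded.1, h.bounded.2⟩

lemma isStronglyEssBounded_riccatiFeedback (h : IsRiccatiSolution Y B P₀ W R T P V)
    (hLQ : IsLQData (Icc 0 T) B P₀ W R δ) :
    IsStronglyEssBounded (volume.restrict (Icc 0 T)) (riccatiFeedback B R P) :=
  (IsStronglyEssBounded.of_forall_continuousOn_apply isCompact_Icc fun _ =>
    hLQ.continuousOn_inverse_adjoint.clm_apply continuousOn_const).comp h.isStronglyEssBounded

lemma isStronglyEssBounded_input_comp_riccatiFeedback (h : IsRiccatiSolution Y B P₀ W R T P V)
    (hLQ : IsLQData (Icc 0 T) B P₀ W R δ) :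
    IsStronglyEssBounded (volume.restrict (Icc 0 T))
      (fun t => B t ∘L riccatiFeedback B R P t) :=
  (IsStronglyEssBounded.of_forall_continuousOn_apply isCompact_Icc fun _ =>
    hLQ.continuousOn_input.clm_apply continuousOn_const).comp
    (h.isStronglyEssBounded_riccatiFeedback hLQ)

lemma isStronglyEssBounded_weight (h : IsRiccatiSolution Y B P₀ W R T P V)
    (hLQ : IsLQData (Icc 0 T) B P₀ W R δ) :
    IsStronglyEssBounded (volume.restrict (Icc 0 T))
      (fun t => W t + P t ∘L B t ∘L riccatiFeedback B R P t) :=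
  (IsStronglyEssBounded.of_forall_continuousOn_apply isCompact_Icc fun _ =>
    hLQ.continuousOn_stateWeight.clm_apply continuousOn_const).add
    (h.isStronglyEssBounded.comp (h.isStronglyEssBounded_input_comp_riccatiFeedback hLQ))

lemma isUniformlyBounded_closedLoop (h : IsRiccatiSolution Y B P₀ W R T P V)
    (hLQ : IsLQData (Icc 0 T) B P₀ W R δ) (hY_bdd : IsUniformlyBounded (Icc 0 T) Y) :
    IsUniformlyBounded (Icc 0 T) V :=
  h.closedLoop.isUniformlyBounded
    (h.isStronglyEssBounded_input_comp_riccatiFeedback hLQ).neg.exists_bound hY_bdd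

lemma isSelfAdjoint (h : IsRiccatiSolution Y B P₀ W R T P V)
    (hLQ : IsLQData (Icc 0 T) B P₀ W R δ) (hY_bdd : IsUniformlyBounded (Icc 0 T) Y)
    (hs : s ∈ Icc 0 T) : IsSelfAdjoint (P s) :=
  h.isLyapunovSolution.isSelfAdjoint h.closedLoop.evolution
    (h.isUniformlyBounded_closedLoop hLQ hY_bdd) (h.isStronglyEssBounded_weight hLQ)
    hLQ.isPositive_terminalWeight.isSelfAdjoint
    (fun r hr => (hLQ.isPositive_stateWeight r hr).isSelfAdjoint)
    (N := fun r => B r ∘L (R r).inverse ∘L (B r).adjoint)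
    (fun _ hr => hLQ.isSelfAdjoint_input_inverse_adjoint hr)
    (isCompact_Icc.exists_bound_of_continuousOn
      (hLQ.continuousOn_input.clm_comp hLQ.continuousOn_inverse_adjoint))
    (fun _ _ => rfl) hs

lemma inner_apply_input (h : IsRiccatiSolution Y B P₀ W R T P V)
    (hLQ : IsLQData (Icc 0 T) B P₀ W R δ) (hY_bdd : IsUniformlyBounded (Icc 0 T) Y)
    (hs : s ∈ Icc 0 T) (x : H) (v : X) :
    ⟪x, P s (B s v)⟫_𝕜 = ⟪riccatiFeedback B R P s x, R s v⟫_𝕜 := by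
  have hP := (h.isSelfAdjoint hLQ hY_bdd hs).isSymmetric
  have hR := hLQ.isSymmetric_controlWeight s hs
  have hinv := apply_inverse_of_coercive hLQ.coercivity_pos (hLQ.coercive_controlWeight s hs)
  calc ⟪x, P s (B s v)⟫_𝕜 = ⟪(B s).adjoint (P s x), v⟫_𝕜 := by
        rw [ContinuousLinearMap.adjoint_inner_left]
        exact (hP x (B s v)).symm
    _ = ⟪R s (riccatiFeedback B R P s x), v⟫_𝕜 := by rw [← hinv ((B s).adjoint (P s x))]; rfl
    _ = ⟪riccatiFeedback B R P s x, R s v⟫_𝕜 := hR _ _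

lemma memLp_top_closedLoop (h : IsRiccatiSolution Y B P₀ W R T P V)
    (hLQ : IsLQData (Icc 0 T) B P₀ W R δ) (hs : s ∈ Icc 0 T) (x : H) :
    MemLp (fun r => V r s x) ⊤ (volume.restrict (Icc s T)) ∧
      MemLp (fun r => -riccatiFeedback B R P r (V r s x)) ⊤ (volume.restrict (Icc s T)) := by
  have hsub : Icc s T ⊆ Icc 0 T := Icc_subset_Icc_left hs.1
  have hVx := (h.closedLoop.evolution.mono hsub).memLp_top_left hs.2 x
  exact ⟨hVx, ((h.isStronglyEssBounded_riccatiFeedback hLQ).mono_measure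
    (Measure.restrict_mono_set volume hsub)).memLp_apply hVx |>.neg⟩

lemma re_inner_apply_eq_lqPairing (h : IsRiccatiSolution Y B P₀ W R T P V)
    (hLQ : IsLQData (Icc 0 T) B P₀ W R δ) (hY_bdd : IsUniformlyBounded (Icc 0 T) Y)
    (hs : s ∈ Icc 0 T) {z : ℝ → H} (hz : MemLp z ⊤ (volume.restrict (Icc s T))) {u : ℝ → X}
    (hu : MemLp u ⊤ (volume.restrict (Icc s T))) {x : H}
    (hz_eq : ∀ t ∈ Icc s T, z t =
      V t s x + ∫ r in s..t, V t r (B r (u r + riccatiFeedback B R P r (z r)))) :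
    RCLike.re ⟪x, P s x⟫_𝕜 = lqPairing P₀ W R s T (fun r => V r s x)
      (fun r => -riccatiFeedback B R P r (V r s x)) z u := by
  have hsub : Icc s T ⊆ Icc 0 T := Icc_subset_Icc_left hs.1
  have hrestrict := Measure.restrict_mono_set volume hsub
  have hV := h.closedLoop.evolution.mono hsub
  have hVx := hV.memLp_top_left hs.2 x
  have hK := (h.isStronglyEssBounded_riccatiFeedback hLQ).mono_measure hrestrict
  have hQ := (h.isStronglyEssBounded_weight hLQ).mono_measure hrestrict
  have hP := h.isStronglyEssBounded.mono_measure hrestrict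
  have hB : IsStronglyEssBounded (volume.restrict (Icc s T)) B :=
    .of_forall_continuousOn_apply isCompact_Icc fun _ =>
      (hLQ.mono hsub).continuousOn_input.clm_apply continuousOn_const
  have hf := hB.memLp_apply (hu.add (hK.memLp_apply hz))
  have hduality := (h.isLyapunovSolution.mono_left hs.1).inner_mild_trajectory hV
    ((h.isUniformlyBounded_closedLoop hLQ hY_bdd).mono hsub) hs.2 hQ hP hf hz_eq x
  have hQz := intervalIntegrable_of_memLp_top hs.2
    (memLp_top_inner (𝕜 := 𝕜) hVx (hQ.memLp_apply hz))
  have hPf := intervalIntegrable_of_memLp_top hs.2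
    (memLp_top_inner (𝕜 := 𝕜) hVx (hP.memLp_apply hf))
  rw [← sub_eq_iff_eq_add, add_sub_assoc, ← intervalIntegral.integral_sub hQz hPf] at hduality
  rw [← hduality, map_add]
  refine congrArg₂ (· + ·) rfl ((intervalIntegral.intervalIntegral_re (hQz.sub hPf)).symm.trans
    (intervalIntegral.integral_congr fun r hr => ?_))
  rw [uIcc_of_le hs.2] at hr
  simp only [Pi.add_apply, map_add, add_apply, inner_add_right, ContinuousLinearMap.comp_apply,
    inner_neg_left, h.inner_apply_input hLQ hY_bdd (hsub hr), map_sub, map_neg]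
  ring

lemma re_inner_apply_eq_lqPairing_self (h : IsRiccatiSolution Y B P₀ W R T P V)
    (hLQ : IsLQData (Icc 0 T) B P₀ W R δ) (hY_bdd : IsUniformlyBounded (Icc 0 T) Y)
    (hs : s ∈ Icc 0 T) (x : H) :
    RCLike.re ⟪x, P s x⟫_𝕜 = lqPairing P₀ W R s T
      (fun r => V r s x) (fun r => -riccatiFeedback B R P r (V r s x))
      (fun r => V r s x) (fun r => -riccatiFeedback B R P r (V r s x)) := by
  obtain ⟨hVx, hKVx⟩ := h.memLp_top_closedLoop hLQ hs x
  exact h.re_inner_apply_eq_lqPairing hLQ hY_bdd hs hVx hKVx fun t _ => by simp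

lemma re_inner_apply_le_lqPairing (h : IsRiccatiSolution Y B P₀ W R T P V)
    (hLQ : IsLQData (Icc 0 T) B P₀ W R δ) (hY_bdd : IsUniformlyBounded (Icc 0 T) Y)
    (hs : s ∈ Icc 0 T) {z : ℝ → H} (hz : MemLp z ⊤ (volume.restrict (Icc s T))) {u : ℝ → X}
    (hu : MemLp u ⊤ (volume.restrict (Icc s T))) {x : H}
    (hz_eq : ∀ t ∈ Icc s T, z t =
      V t s x + ∫ r in s..t, V t r (B r (u r + riccatiFeedback B R P r (z r)))) :
    RCLike.re ⟪x, P s x⟫_𝕜 ≤ lqPairing P₀ W R s T z u z u := by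
  obtain ⟨hVx, hKVx⟩ := h.memLp_top_closedLoop hLQ hs x
  have hpolar := (hLQ.mono (Icc_subset_Icc_left hs.1)).two_mul_lqPairing_le hs.2 hVx hKVx hz hu
  have hcross := h.re_inner_apply_eq_lqPairing hLQ hY_bdd hs hz hu hz_eq
  have hself := h.re_inner_apply_eq_lqPairing_self hLQ hY_bdd hs x
  rw [← hcross, ← hself] at hpolar
  linarith

lemma re_inner_apply_le_lqPairing_feedback (h : IsRiccatiSolution Y B P₀ W R T P V)
    (hLQ : IsLQData (Icc 0 T) B P₀ W R δ) (hY : IsEvolutionOperator (Icc 0 T) Y)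
    (hY_bdd : IsUniformlyBounded (Icc 0 T) Y) (hs : s ∈ Icc 0 T) {F : ℝ → H →L[𝕜] X}
    {Z : ℝ → ℝ → H →L[𝕜] H} (hF : IsStronglyEssBounded (volume.restrict (Icc 0 T)) F)
    (hZ : IsPerturbedEvolutionOperator (Icc 0 T) Y (fun t => B t ∘L F t) Z) (x : H) :
    RCLike.re ⟪x, P s x⟫_𝕜 ≤ lqPairing P₀ W R s T
      (fun r => Z r s x) (fun r => F r (Z r s x)) (fun r => Z r s x) (fun r => F r (Z r s x)) := by
  have hsub : Icc s T ⊆ Icc 0 T := Icc_subset_Icc_left hs.1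
  have hrestrict := Measure.restrict_mono_set volume hsub
  have hZx := (hZ.evolution.mono hsub).memLp_top_left hs.2 x
  have hF' := hF.mono_measure hrestrict
  have hB : IsStronglyEssBounded (volume.restrict (Icc s T)) B :=
    .of_forall_continuousOn_apply isCompact_Icc fun _ =>
      (hLQ.mono hsub).continuousOn_input.clm_apply continuousOn_const
  refine h.re_inner_apply_le_lqPairing hLQ hY_bdd hs hZx (hF'.memLp_apply hZx) fun t ht => ?_
  have hduhamel := (h.closedLoop.mono hsub).apply_eq_add_integral (hY.mono hsub) (hZ.mono hsub)
    (hY_bdd.mono hsub)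
    ((h.isStronglyEssBounded_input_comp_riccatiFeedback hLQ).neg.mono_measure hrestrict)
    (hB.comp hF') ht x
  simpa only [sub_neg_eq_add, add_apply, ContinuousLinearMap.comp_apply, ← map_add] using hduhamel

lemma integral_runningCost_closedLoop_le (h : IsRiccatiSolution Y B P₀ W R T P V)
    (hLQ : IsLQData (Icc 0 T) B P₀ W R δ) (hY_bdd : IsUniformlyBounded (Icc 0 T) Y)
    (hs : s ∈ Icc 0 T) {t : ℝ} (ht : t ∈ Icc s T) (x : H) :
    ∫ r in s..t, (RCLike.re ⟪V r s x, W r (V r s x)⟫_𝕜 +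
        RCLike.re ⟪riccatiFeedback B R P r (V r s x),
          R r (riccatiFeedback B R P r (V r s x))⟫_𝕜) ≤ RCLike.re ⟪x, P s x⟫_𝕜 := by
  obtain ⟨hVx, hKVx⟩ := h.memLp_top_closedLoop hLQ hs x
  rw [h.re_inner_apply_eq_lqPairing_self hLQ hY_bdd hs x]
  simpa only [map_neg, inner_neg_neg] using
    (hLQ.mono (Icc_subset_Icc_left hs.1)).integral_runningCost_le_lqPairing ht hVx hKVx

lemma intervalIntegrable_runningCost_closedLoop (h : IsRiccatiSolution Y B P₀ W R T P V)
    (hLQ : IsLQData (Icc 0 T) B P₀ W R δ) (hs : s ∈ Icc 0 T) (x : H) :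
    IntervalIntegrable (fun r => RCLike.re ⟪V r s x, W r (V r s x)⟫_𝕜 +
      RCLike.re ⟪riccatiFeedback B R P r (V r s x), R r (riccatiFeedback B R P r (V r s x))⟫_𝕜)
      volume s T := by
  obtain ⟨hVx, hKVx⟩ := h.memLp_top_closedLoop hLQ hs x
  simpa only [map_neg, inner_neg_neg] using
    (hLQ.mono (Icc_subset_Icc_left hs.1)).intervalIntegrable_runningCost hs.2 hVx hKVx hVx hKVx

lemma isPositive (h : IsRiccatiSolution Y B P₀ W R T P V)
    (hLQ : IsLQData (Icc 0 T) B P₀ W R δ) (hY_bdd : IsUniformlyBounded (Icc 0 T) Y)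
    (hs : s ∈ Icc 0 T) : (P s).IsPositive := by
  refine ⟨(h.isSelfAdjoint hLQ hY_bdd hs).isSymmetric, fun x => ?_⟩
  rw [ContinuousLinearMap.reApplyInnerSelf_apply, inner_re_symm]
  simpa only [intervalIntegral.integral_same] using
    h.integral_runningCost_closedLoop_le hLQ hY_bdd hs (left_mem_Icc.2 hs.2) x

end IsRiccatiSolution

end Riccati

section UniformBounds

variable {𝕜 : Type*} [RCLike 𝕜]
  {H : Type*} [NormedAddCommGroup H] [InnerProductSpace 𝕜 H]
  {X : Type*} [NormedAddCommGroup X] [InnerProductSpace 𝕜 X]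
  {X' : Type*} [NormedAddCommGroup X'] [InnerProductSpace 𝕜 X']

lemma lqPairing_self_le_of_exp_decay {P₀ : H →L[𝕜] H} {W : ℝ → H →L[𝕜] H} {R : ℝ → X →L[𝕜] X}
    {z : ℝ → H} {u : ℝ → X} {a b α cW cR m k : ℝ} (hab : a ≤ b) (hα : 0 < α)
    (hW : ∀ r ∈ Icc a b, ‖W r‖ ≤ cW) (hR : ∀ r ∈ Icc a b, ‖R r‖ ≤ cR)
    (hz : ∀ r ∈ Icc a b, ‖z r‖ ≤ m * Real.exp (-α * (r - a)))
    (hu : ∀ r ∈ Icc a b, ‖u r‖ ≤ k * Real.exp (-α * (r - a))) :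
    lqPairing P₀ W R a b z u z u ≤
      ‖P₀‖ * m ^ 2 + (cW * m ^ 2 + cR * k ^ 2) * (1 / (2 * α)) := by
  have ha := left_mem_Icc.2 hab
  have hb := right_mem_Icc.2 hab
  have hcW : 0 ≤ cW := (norm_nonneg _).trans (hW a ha)
  have hcR : 0 ≤ cR := (norm_nonneg _).trans (hR a ha)
  have hm : 0 ≤ m := by simpa using (norm_nonneg _).trans (hz a ha)
  have hzb : ‖z b‖ ≤ m := (hz b hb).trans (mul_le_of_le_one_right hm
    (exp_neg_mul_le_one hα.le (sub_nonneg.2 hab)))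
  have hterminal : RCLike.re ⟪z b, P₀ (z b)⟫_𝕜 ≤ ‖P₀‖ * m ^ 2 :=
    (le_abs_self _).trans (abs_re_inner_apply_self_le le_rfl hzb)
  have hrunning := norm_intervalIntegral_le_mul_integral
    (f := fun r => RCLike.re ⟪z r, W r (z r)⟫_𝕜 + RCLike.re ⟪u r, R r (u r)⟫_𝕜)
    (C := cW * m ^ 2 + cR * k ^ 2) (g := fun r => Real.exp (-(2 * α) * (r - a))) hab (by fun_prop)
    (ae_restrict_of_forall_mem measurableSet_Icc fun r hr => by
      rw [exp_neg_two_mul_mul, add_mul, mul_assoc, mul_assoc, ← mul_pow, ← mul_pow]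
      exact norm_add_le_of_le (abs_re_inner_apply_self_le (hW r hr) (hz r hr))
        (abs_re_inner_apply_self_le (hR r hr) (hu r hr)))
  refine add_le_add hterminal ((le_abs_self _).trans (hrunning.trans ?_))
  gcongr
  exact intervalIntegral_exp_neg_mul_sub_left_le (by positivity) a b

lemma norm_integral_apply_le_of_exp_bound [NormedSpace ℝ H] {U : ℝ → X →L[𝕜] H} {d : ℝ → X}
    {q : ℝ → ℝ} {s t M β : ℝ} (hst : s ≤ t) (hβ : 0 < β)
    (hU : ∀ r ∈ Icc s t, ‖U r‖ ≤ M * Real.exp (-β * (t - r)))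
    (hd : ∀ r ∈ Icc s t, ‖d r‖ ^ 2 ≤ q r) (hq : IntervalIntegrable q volume s t) :
    ‖∫ r in s..t, U r (d r)‖ ≤ M / 2 * (1 / (2 * β) + ∫ r in s..t, q r) := by
  have hM : 0 ≤ M := by simpa using (norm_nonneg _).trans (hU t (right_mem_Icc.2 hst))
  have hexp_int : IntervalIntegrable (fun r => Real.exp (-(2 * β) * (t - r))) volume s t :=
    Continuous.intervalIntegrable (by fun_prop) s t
  have hpointwise : ∀ r ∈ Icc s t,
      ‖U r (d r)‖ ≤ M / 2 * (Real.exp (-(2 * β) * (t - r)) + q r) := fun r hr => by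
    calc ‖U r (d r)‖ ≤ M / 2 * (2 * Real.exp (-β * (t - r)) * ‖d r‖) :=
          ((U r).le_of_opNorm_le (hU r hr) (d r)).trans_eq (by ring)
      _ ≤ M / 2 * (Real.exp (-(2 * β) * (t - r)) + q r) := by
          rw [exp_neg_two_mul_mul]
          gcongr
          exact (two_mul_le_add_sq _ _).trans (add_le_add_right (hd r hr) _)
  calc ‖∫ r in s..t, U r (d r)‖
      ≤ ∫ r in s..t, M / 2 * (Real.exp (-(2 * β) * (t - r)) + q r) :=
        intervalIntegral.norm_integral_le_of_norm_le hst
          (Filter.Eventually.of_forall fun r hr => hpointwise r (Ioc_subset_Icc_self hr))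
          ((hexp_int.add hq).const_mul _)
    _ ≤ M / 2 * (1 / (2 * β) + ∫ r in s..t, q r) := by
        rw [intervalIntegral.integral_const_mul, intervalIntegral.integral_add hexp_int hq]
        gcongr
        exact intervalIntegral_exp_neg_mul_sub_right_le (by positivity) s t

lemma IsLQData.sq_norm_input_add_injection_le {I : Set ℝ} {B : ℝ → X →L[𝕜] H} {P₀ : H →L[𝕜] H}
    {W : ℝ → H →L[𝕜] H} {R : ℝ → X →L[𝕜] X} {δ t cB cL : ℝ} {L : X' →L[𝕜] H} {x : H} {y : X'}
    (hLQ : IsLQData I B P₀ W R δ) (ht : t ∈ I) (hB : ‖B t‖ ≤ cB) (hL : ‖L‖ ≤ cL)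
    (hy : ‖y‖ ^ 2 ≤ RCLike.re ⟪x, W t x⟫_𝕜) (v : X) :
    ‖B t v + L y‖ ^ 2 ≤ 2 * (cB ^ 2 / δ + cL ^ 2) *
      (RCLike.re ⟪x, W t x⟫_𝕜 + RCLike.re ⟪v, R t v⟫_𝕜) := by
  have hδ := hLQ.coercivity_pos
  have hv : ‖v‖ ^ 2 ≤ RCLike.re ⟪v, R t v⟫_𝕜 / δ :=
    (le_div_iff₀' hδ).2 (hLQ.coercive_controlWeight t ht v)
  have hW := (hLQ.isPositive_stateWeight t ht).re_inner_nonneg_right x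
  have hR := (hLQ.isPositive_controlWeight ht).re_inner_nonneg_right v
  calc ‖B t v + L y‖ ^ 2 ≤ (cB * ‖v‖ + cL * ‖y‖) ^ 2 := by
        gcongr
        exact norm_add_le_of_le ((B t).le_of_opNorm_le hB v) (L.le_of_opNorm_le hL y)
    _ ≤ 2 * ((cB * ‖v‖) ^ 2 + (cL * ‖y‖) ^ 2) := add_sq_le
    _ = 2 * (cB ^ 2 * ‖v‖ ^ 2 + cL ^ 2 * ‖y‖ ^ 2) := by ring
    _ ≤ 2 * (cB ^ 2 * (RCLike.re ⟪v, R t v⟫_𝕜 / δ) + cL ^ 2 * RCLike.re ⟪x, W t x⟫_𝕜) := by gcongr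
    _ ≤ 2 * (cB ^ 2 * (RCLike.re ⟪v, R t v⟫_𝕜 / δ) + cL ^ 2 * RCLike.re ⟪x, W t x⟫_𝕜) +
        2 * (cB ^ 2 / δ * RCLike.re ⟪x, W t x⟫_𝕜 + cL ^ 2 * RCLike.re ⟪v, R t v⟫_𝕜) :=
        le_add_of_nonneg_right (by positivity)
    _ = _ := by ring

variable [NormedSpace ℝ H] [CompleteSpace H]

lemma IsEvolutionOperator.isUniformlyBounded_of_isExponentiallyStable_perturbation
    {Y V : ℝ → ℝ → H →L[𝕜] H} {D : ℝ → H →L[𝕜] H} (hY : IsEvolutionOperator (Ici 0) Y)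
    (hV : IsPerturbedEvolutionOperator (Ici 0) Y D V) (hD : ContinuousOn D (Ici 0))
    (hV_stable : IsExponentiallyStable V) (T : ℝ) : IsUniformlyBounded (Icc 0 T) Y := by
  have hsub : Icc 0 T ⊆ Ici 0 := Icc_subset_Ici_self
  obtain ⟨c, hc⟩ := isCompact_Icc.exists_bound_of_continuousOn (hD.mono hsub)
  exact (hV.mono hsub).isUniformlyBounded_unperturbed (hY.mono hsub)
    ⟨c, ae_restrict_of_forall_mem measurableSet_Icc hc⟩ (hV_stable.isUniformlyBounded.mono hsub)

variable [CompleteSpace X] {Y V : ℝ → ℝ → H →L[𝕜] H} {B : ℝ → X →L[𝕜] H} {P₀ : H →L[𝕜] H}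
  {W P : ℝ → H →L[𝕜] H} {R : ℝ → X →L[𝕜] X} {T δ : ℝ}

lemma IsRiccatiSolution.norm_le_of_exp_stable_feedback (h : IsRiccatiSolution Y B P₀ W R T P V)
    (hLQ : IsLQData (Icc 0 T) B P₀ W R δ) (hY : IsEvolutionOperator (Icc 0 T) Y)
    (hY_bdd : IsUniformlyBounded (Icc 0 T) Y) {F : ℝ → H →L[𝕜] X} {Z : ℝ → ℝ → H →L[𝕜] H}
    (hF : IsStronglyEssBounded (volume.restrict (Icc 0 T)) F)
    (hZ : IsPerturbedEvolutionOperator (Icc 0 T) Y (fun t => B t ∘L F t) Z) {cW cR cF M α : ℝ}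
    (hW_le : ∀ t ∈ Icc 0 T, ‖W t‖ ≤ cW) (hR_le : ∀ t ∈ Icc 0 T, ‖R t‖ ≤ cR)
    (hF_le : ∀ t ∈ Icc 0 T, ‖F t‖ ≤ cF) (hα : 0 < α)
    (hZ_le : ∀ s t, 0 ≤ s → s ≤ t → ‖Z t s‖ ≤ M * Real.exp (-α * (t - s))) {s : ℝ}
    (hs : s ∈ Icc 0 T) :
    ‖P s‖ ≤ ‖P₀‖ * M ^ 2 + (cW * M ^ 2 + cR * (cF * M) ^ 2) * (1 / (2 * α)) := by
  have hsub : Icc s T ⊆ Icc 0 T := Icc_subset_Icc_left hs.1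
  have hcW : 0 ≤ cW := (norm_nonneg _).trans (hW_le s hs)
  have hcR : 0 ≤ cR := (norm_nonneg _).trans (hR_le s hs)
  refine opNorm_le_of_isPositive_of_re_inner_le (h.isPositive hLQ hY_bdd hs) (by positivity)
    fun x hx => ?_
  have hZx : ∀ r ∈ Icc s T, ‖Z r s x‖ ≤ M * Real.exp (-α * (r - s)) := fun r hr => by
    simpa [hx] using (Z r s).le_of_opNorm_le (hZ_le s r hs.1 hr.1) x
  refine (h.re_inner_apply_le_lqPairing_feedback hLQ hY hY_bdd hs hF hZ x).trans
    (lqPairing_self_le_of_exp_decay hs.2 hα (fun r hr => hW_le r (hsub hr))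
      (fun r hr => hR_le r (hsub hr)) hZx fun r hr => ?_)
  rw [mul_assoc]
  exact (F r).le_of_opNorm_le_of_le (hF_le r (hsub hr)) (hZx r hr)

theorem exists_riccati_bound_of_isUniformlyStabilizable (hY : IsEvolutionOperator (Ici 0) Y)
    (hLQ : IsLQData (Ici 0) B P₀ W R δ) (hW : ∃ c, ∀ t, 0 ≤ t → ‖W t‖ ≤ c)
    (hR : ∃ c, ∀ t, 0 ≤ t → ‖R t‖ ≤ c) (hstab : IsUniformlyStabilizable Y B) :
    ∃ δ_P, ∀ T P V, IsRiccatiSolution Y B P₀ W R T P V → ∀ s ∈ Icc 0 T, ‖P s‖ ≤ δ_P := by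
  obtain ⟨cW, hcW⟩ := hW
  obtain ⟨cR, hcR⟩ := hR
  obtain ⟨F, ⟨hF, cF, hcF⟩, Z, hZ, hZ_stable⟩ := hstab
  have hY_bdd := hY.isUniformlyBounded_of_isExponentiallyStable_perturbation hZ
    (hLQ.continuousOn_input.clm_comp hF) hZ_stable
  obtain ⟨M, -, α, hα, hM⟩ := hZ_stable
  refine ⟨‖P₀‖ * M ^ 2 + (cW * M ^ 2 + cR * (cF * M) ^ 2) * (1 / (2 * α)), fun T P V h s hs => ?_⟩
  have hsub : Icc 0 T ⊆ Ici 0 := Icc_subset_Ici_self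
  exact h.norm_le_of_exp_stable_feedback (hLQ.mono hsub) (hY.mono hsub) (hY_bdd T)
    (.of_forall_continuousOn_apply isCompact_Icc fun _ =>
      (hF.mono hsub).clm_apply continuousOn_const)
    (hZ.mono hsub) (fun t ht => hcW t ht.1) (fun t ht => hcR t ht.1) (fun t ht => hcF t ht.1) hα
    hM hs

lemma IsRiccatiSolution.norm_closedLoop_le_of_exp_stable_injection
    (h : IsRiccatiSolution Y B P₀ W R T P V)
    (hLQ : IsLQData (Icc 0 T) B P₀ W R δ) (hY : IsEvolutionOperator (Icc 0 T) Y)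
    (hY_bdd : IsUniformlyBounded (Icc 0 T) Y) {C : ℝ → H →L[𝕜] X'} {L : ℝ → X' →L[𝕜] H}
    {Z : ℝ → ℝ → H →L[𝕜] H}
    (hLC : IsStronglyEssBounded (volume.restrict (Icc 0 T)) fun t => L t ∘L C t)
    (hC : ∀ t ∈ Icc 0 T, ∀ x, ‖C t x‖ ^ 2 ≤ RCLike.re ⟪x, W t x⟫_𝕜)
    (hZ : IsPerturbedEvolutionOperator (Icc 0 T) Y (fun t => L t ∘L C t) Z) {cB cL p M β : ℝ}
    (hB_le : ∀ t ∈ Icc 0 T, ‖B t‖ ≤ cB) (hL_le : ∀ t ∈ Icc 0 T, ‖L t‖ ≤ cL) (hβ : 0 < β)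
    (hZ_le : ∀ s t, 0 ≤ s → s ≤ t → ‖Z t s‖ ≤ M * Real.exp (-β * (t - s))) {s t : ℝ}
    (hs : s ∈ Icc 0 T) (hPs : ‖P s‖ ≤ p) (ht : t ∈ Icc s T) :
    ‖V t s‖ ≤ M + M / 2 * (1 / (2 * β) + 2 * (cB ^ 2 / δ + cL ^ 2) * p) := by
  have hδ := hLQ.coercivity_pos
  have hsub : Icc s T ⊆ Icc 0 T := Icc_subset_Icc_left hs.1
  have hrestrict := Measure.restrict_mono_set volume hsub
  have hp : 0 ≤ p := (norm_nonneg _).trans hPs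
  have hM : 0 ≤ M := by simpa using (norm_nonneg _).trans (hZ_le s s hs.1 le_rfl)
  refine ContinuousLinearMap.opNorm_le_of_unit_norm (by positivity) fun x hx => ?_
  set cost : ℝ → ℝ := fun r => RCLike.re ⟪V r s x, W r (V r s x)⟫_𝕜 +
    RCLike.re ⟪riccatiFeedback B R P r (V r s x), R r (riccatiFeedback B R P r (V r s x))⟫_𝕜
  have hcost_int : IntervalIntegrable cost volume s t :=
    (h.intervalIntegrable_runningCost_closedLoop hLQ hs x).mono_set
      (by simpa only [uIcc_of_le ht.1, uIcc_of_le hs.2] using Icc_subset_Icc_right ht.2)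
  have hcost_le : ∫ r in s..t, cost r ≤ p :=
    (h.integral_runningCost_closedLoop_le hLQ hY_bdd hs ht x).trans <| (le_abs_self _).trans <| by
      simpa using abs_re_inner_apply_self_le (𝕜 := 𝕜) hPs hx.le
  have hduhamel := (hZ.mono hsub).apply_eq_add_integral (hY.mono hsub) (h.closedLoop.mono hsub)
    (hY_bdd.mono hsub) (hLC.mono_measure hrestrict)
    ((h.isStronglyEssBounded_input_comp_riccatiFeedback hLQ).neg.mono_measure hrestrict) ht x
  have hforcing : ∀ r ∈ Icc s t,
      ‖(-(B r ∘L riccatiFeedback B R P r) - L r ∘L C r) (V r s x)‖ ^ 2 ≤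
        2 * (cB ^ 2 / δ + cL ^ 2) * cost r := fun r hr => by
    have hr' : r ∈ Icc 0 T := hsub ⟨hr.1, hr.2.trans ht.2⟩
    rw [← neg_add', neg_apply, norm_neg]
    exact hLQ.sq_norm_input_add_injection_le hr' (hB_le r hr') (hL_le r hr') (hC r hr' _) _
  have hintegral := norm_integral_apply_le_of_exp_bound ht.1 hβ
    (fun r hr => hZ_le r t (hs.1.trans hr.1) hr.2) hforcing (hcost_int.const_mul _)
  rw [intervalIntegral.integral_const_mul] at hintegral
  rw [hduhamel]
  refine norm_add_le_of_le ?_ (hintegral.trans (by gcongr))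
  have hZ_le_M : ‖Z t s‖ ≤ M := (hZ_le s t hs.1 ht.1).trans (mul_le_of_le_one_right hM
    (exp_neg_mul_le_one hβ.le (sub_nonneg.2 ht.1)))
  simpa [hx] using (Z t s).le_of_opNorm_le hZ_le_M x

theorem exists_closedLoop_bound_of_isUniformlyDetectable (hY : IsEvolutionOperator (Ici 0) Y)
    (hLQ : IsLQData (Ici 0) B P₀ W R δ) (hB : ∃ c, ∀ t, 0 ≤ t → ‖B t‖ ≤ c)
    {C : ℝ → H →L[𝕜] X'} (hC : ContinuousOn C (Ici 0))
    (hCW : ∀ t, 0 ≤ t → ∀ x, ‖C t x‖ ^ 2 ≤ RCLike.re ⟪x, W t x⟫_𝕜)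
    (hdet : IsUniformlyDetectable Y C) (δ_P : ℝ) :
    ∃ δ_Y, ∀ T P V, IsRiccatiSolution Y B P₀ W R T P V → (∀ s ∈ Icc 0 T, ‖P s‖ ≤ δ_P) →
      ∀ s t, 0 ≤ s → s ≤ t → t ≤ T → ‖V t s‖ ≤ δ_Y := by
  obtain ⟨cB, hcB⟩ := hB
  obtain ⟨L, ⟨hL, cL, hcL⟩, Z, hZ, hZ_stable⟩ := hdet
  have hLC : ContinuousOn (fun t => L t ∘L C t) (Ici 0) := hL.clm_comp hC
  have hY_bdd := hY.isUniformlyBounded_of_isExponentiallyStable_perturbation hZ hLC hZ_stable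
  obtain ⟨M, -, β, hβ, hM⟩ := hZ_stable
  refine ⟨M + M / 2 * (1 / (2 * β) + 2 * (cB ^ 2 / δ + cL ^ 2) * δ_P),
    fun T P V h hP s t hs hst ht => ?_⟩
  have hsub : Icc 0 T ⊆ Ici 0 := Icc_subset_Ici_self
  exact h.norm_closedLoop_le_of_exp_stable_injection (hLQ.mono hsub) (hY.mono hsub) (hY_bdd T)
    (.of_forall_continuousOn_apply isCompact_Icc fun _ =>
      (hLC.mono hsub).clm_apply continuousOn_const)
    (fun t ht => hCW t ht.1) (hZ.mono hsub) (fun t ht => hcB t ht.1) (fun t ht => hcL t ht.1) hβ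
    hM ⟨hs, hst.trans ht⟩ (hP s ⟨hs, hst.trans ht⟩) ⟨hst, ht⟩

end UniformBounds

section PositiveSqrt

variable {𝕜 : Type*} [RCLike 𝕜]
  {H : Type*} [NormedAddCommGroup H] [InnerProductSpace 𝕜 H] {S W : ℝ → H →L[𝕜] H}

namespace IsPositiveSqrt

lemma continuousOn (hS : IsPositiveSqrt S W) (hW : ContinuousOn W (Ici 0)) :
    ContinuousOn S (Ici 0) :=
  continuousOn_of_isPositive_of_comp_self (fun t ht => (hS t ht).1)
    (hW.congr fun t ht => (hS t ht).2)

lemma sq_norm_apply (hS : IsPositiveSqrt S W) {t : ℝ} (ht : 0 ≤ t) (x : H) :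
    ‖S t x‖ ^ 2 = RCLike.re ⟪x, W t x⟫_𝕜 := by
  rw [norm_sq_eq_re_inner (𝕜 := 𝕜), (hS t ht).1.inner_left_eq_inner_right, ← (hS t ht).2,
    ContinuousLinearMap.comp_apply]

end IsPositiveSqrt

end PositiveSqrt

theorem mainTheorem6 {𝕜 : Type*} [RCLike 𝕜]
    {H : Type*} [NormedAddCommGroup H] [InnerProductSpace 𝕜 H] [NormedSpace ℝ H] [CompleteSpace H]
    {X : Type*} [NormedAddCommGroup X] [InnerProductSpace 𝕜 X] [CompleteSpace X]
    (Y : ℝ → ℝ → H →L[𝕜] H) (B : ℝ → X →L[𝕜] H)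
    (P₀ : H →L[𝕜] H) (W W_sqrt : ℝ → H →L[𝕜] H) (R : ℝ → X →L[𝕜] X)
    (hY : IsEvolutionOperator (Ici 0) Y)
    (hB : IsBoundedContinuous B)
    (hP₀ : P₀.IsPositive)
    (hW : IsBoundedContinuous W) (hW_pos : ∀ t : ℝ, 0 ≤ t → (W t).IsPositive)
    (hR : IsBoundedContinuous R) (hR_sa : ∀ t : ℝ, 0 ≤ t → IsSelfAdjoint (R t))
    (hR_coercive : ∃ δ₀ > (0 : ℝ), ∀ t : ℝ, 0 ≤ t → ∀ u : X,
      δ₀ * ‖u‖ ^ 2 ≤ RCLike.re (inner 𝕜 u (R t u)))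
    (hW_sqrt : IsPositiveSqrt W_sqrt W)
    (hstab : IsUniformlyStabilizable Y B)
    (hdet : IsUniformlyDetectable Y W_sqrt) :
    ∃ δ_P δ_Y : ℝ, ∀ T > (0 : ℝ), ∀ (P : ℝ → H →L[𝕜] H) (V : ℝ → ℝ → H →L[𝕜] H),
      IsRiccatiSolution Y B P₀ W R T P V →
        ‖P 0‖ ≤ δ_P ∧ ∀ s t : ℝ, 0 ≤ s → s ≤ t → t ≤ T → ‖V t s‖ ≤ δ_Y := by
  obtain ⟨δ, hδ, hR_coercive⟩ := hR_coercive
  have hLQ : IsLQData (Ici 0) B P₀ W R δ :=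
    ⟨hB.1, hW.1, hR.1, hP₀, hW_pos, fun t ht => (hR_sa t ht).isSymmetric, hδ, hR_coercive⟩
  obtain ⟨δ_P, hδ_P⟩ :=
    exists_riccati_bound_of_isUniformlyStabilizable hY hLQ hW.2 hR.2 hstab
  obtain ⟨δ_Y, hδ_Y⟩ := exists_closedLoop_bound_of_isUniformlyDetectable hY hLQ hB.2
    (hW_sqrt.continuousOn hW.1) (fun t ht x => (hW_sqrt.sq_norm_apply ht x).le) hdet δ_P
  exact ⟨δ_P, δ_Y, fun T hT P V h =>
    ⟨hδ_P T P V h 0 (left_mem_Icc.2 hT.le), hδ_Y T P V h (hδ_P T P V h)⟩⟩
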